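/- Let $F=\mathbb F_q$ be a finite field and let $f(x)=x^2-rx-s$ be irreducible over $F$. Let $H=F^2$ with componentwise addition and the Hall multiplication $(a_1,a_2)(b_1,b_2)=(a_1b_1,\,a_2b_1)$ if $b_2=0$, and $(a_1,a_2)(b_1,b_2)=(a_1b_1-a_2b_2^{-1}f(b_1),\;a_1b_2-a_2b_1+a_2r)$ if $b_2\neq0$. The Hall affine plane has point set $H\times H$; its lines are the vertical lines $x=c$ and the lines $y=xm+k$ $(c,m,k\in H)$. A line is in $BF$ if it is vertical or has slope $m=(m_1,0)$, and in $NBF$ if it has slope $m=(m_1,m_2)$ with $m_2\ne0$. Let $\ell_1\neq\ell_2$ be two lines such that both are in $BF$, or both are in $NBF$, or $\ell_1$ is in $NBF$ and $\ell_2$ is in $BF$. Then for any three distinct points $A_1,B_1,C_1$ of $\ell_1$ that are not on $\ell_2$ there exist three distinct points $A_2,B_2,C_2$ of $\ell_2$ that are not on $\ell_1$ such that the six points form a Pappus configuration; that is, either the pairs of lines $B_1C_2,B_2C_1$; $A_1C_2,A_2C_1$; $A_1B_2,A_2B_1$ meet in points $A_3$, $B_3$, $C_3$, respectively, that lie on one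 line, the nine points being distinct, or the two lines in each of the three pairs are parallel (so that $A_3,B_3,C_3$ lie on the line at infinity of the projective closure). -/

import Mathlib

namespace HallPlane

variable {F : Type*} [Field F] [DecidableEq F]

/-- Multiplication of the Hall system on `F × F` with defining polynomial `x ^ 2 - r x - s`.
Addition is the componentwise addition of `F × F`; the base field is the set of pairs with second
component `0`. -/
def hallMul (r s : F) (a b : F × F) : F × F :=
  if b.2 = 0 then (a.1 * b.1, a.2 * b.1)
  else (a.1 * b.1 - a.2 * b.2⁻¹ * (b.1 ^ 2 - r * b.1 - s), a.1 * b.2 - a.2 * b.1 + a.2 * r)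

/-- Points of the Hall affine plane: ordered pairs of elements of the Hall system. -/
abbrev Point (F : Type*) : Type _ := (F × F) × (F × F)

/-- The vertical line `x = c`. -/
def vertical (c : F × F) : Set (Point F) := {P | P.1 = c}

/-- The non-vertical line `y = x m + k` of slope `m`. -/
def nonVertical (r s : F) (m k : F × F) : Set (Point F) := {P | P.2 = hallMul r s P.1 m + k}

/-- The set of all lines of the Hall affine plane. -/
def lines (r s : F) : Set (Set (Point F)) :=
  {l | (∃ c, l = vertical c) ∨ ∃ m k, l = nonVertical r s m k}

/-- `BF` lines: the vertical lines and the lines whose slope is in the base field. -/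
def IsBF (r s : F) (l : Set (Point F)) : Prop :=
  (∃ c, l = vertical c) ∨ ∃ m k : F × F, m.2 = 0 ∧ l = nonVertical r s m k

/-- `NBF` lines: the non-vertical lines whose slope is not in the base field. -/
def IsNBF (r s : F) (l : Set (Point F)) : Prop :=
  ∃ m k : F × F, m.2 ≠ 0 ∧ l = nonVertical r s m k

end HallPlane

/-- `l` is a line (of the family `L`) through the points `P` and `Q`. -/
def IsLineThrough {X : Type*} (L : Set (Set X)) (P Q : X) (l : Set X) : Prop :=
  l ∈ L ∧ P ∈ l ∧ Q ∈ l

/-- In an affine plane with point set `X` and set of lines `L`, the points `A₁, B₁, C₁` of the line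
`l₁` and `A₂, B₂, C₂` of the line `l₂` form a Pappus configuration. The six points are distinct and
none of them is on both lines. With `a, a'` the lines `B₁C₂, B₂C₁`, with `b, b'` the lines
`A₁C₂, A₂C₁`, and with `c, c'` the lines `A₁B₂, A₂B₁`, either these pairs meet in collinear points
`A₃, B₃, C₃`, all nine points being distinct, or all three pairs are parallel
(then `A₃, B₃, C₃` are on the line at infinity of the projective closure). -/
structure IsPappusConfiguration {X : Type*} (L : Set (Set X)) (l₁ l₂ : Set X)
    (A₁ B₁ C₁ A₂ B₂ C₂ : X) : Prop where
  line₁ : l₁ ∈ L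
  line₂ : l₂ ∈ L
  ne : l₁ ≠ l₂
  memA₁ : A₁ ∈ l₁ \ l₂
  memB₁ : B₁ ∈ l₁ \ l₂
  memC₁ : C₁ ∈ l₁ \ l₂
  memA₂ : A₂ ∈ l₂ \ l₁
  memB₂ : B₂ ∈ l₂ \ l₁
  memC₂ : C₂ ∈ l₂ \ l₁
  nodup : [A₁, B₁, C₁, A₂, B₂, C₂].Nodup
  pappus : ∃ a a' b b' c c' : Set X,
    IsLineThrough L B₁ C₂ a ∧ IsLineThrough L B₂ C₁ a' ∧
    IsLineThrough L A₁ C₂ b ∧ IsLineThrough L A₂ C₁ b' ∧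
    IsLineThrough L A₁ B₂ c ∧ IsLineThrough L A₂ B₁ c' ∧
    ((∃ A₃ B₃ C₃ : X, A₃ ∈ a ∩ a' ∧ B₃ ∈ b ∩ b' ∧ C₃ ∈ c ∩ c' ∧
        [A₁, B₁, C₁, A₂, B₂, C₂, A₃, B₃, C₃].Nodup ∧
        ∃ l₃ ∈ L, A₃ ∈ l₃ ∧ B₃ ∈ l₃ ∧ C₃ ∈ l₃) ∨
      (Disjoint a a' ∧ Disjoint b b' ∧ Disjoint c c'))

/-! Let K be the quadratic extension of F and σ its Frobenius conjugation; call a vector of K × K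
real if conjugation fixes it. The Hall plane is the affine plane K × K in which the K-lines of real
direction are replaced by the Baer subplanes v + eF². The map `ofPoint` carries BF lines to Baer
lines (`baerLine`) and NBF lines to the surviving K-lines (`desLine`). Configurations can therefore
be computed by linear algebra over K; what needs care is that each line used has a direction
belonging to the derived plane.

Parallel lines are settled by a point reflection (`hasPappus_of_translate`). Otherwise a translation
moves the common point to 0, and three cases remain.

Two Baer lines e₁F², e₂F²: explicit configurations, with a Pappus line sF² when the three real
vectors are pairwise independent, and with parallel joins when two of them are dependent
(`exists_pappus_baer_baer`).

A K-line Kd and a Baer line, scaled to F²: conjugation is an involutory collineation with axis F².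
Three points and their images, together with the points where the cross joins meet the axis, form a
Pappus configuration (`of_involution`). A cross join misses the axis only for opposite points bd,
-bd; this situation gets configurations of its own (`pappus_opposite`).

Two K-lines Kd, Ke: in odd characteristic the reflection with axis Ke plays the role of conjugation.
If e is proportional to the conjugate of d, the second reading of the conjugation configuration
applies. For opposite points and in characteristic 2, the affine Pappus configuration with inverse
coordinates and a free parameter z is used; counting the roots of a polynomial in z shows that some
z keeps the required directions non-real (`exists_two_nonvanishing`, `exists_three_nonvanishing`).
-/

/-- Two distinct points lie on at most one line of `L`. -/
def UniqueJoin {X : Type*} (L : Set (Set X)) : Prop :=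
  ∀ l ∈ L, ∀ l' ∈ L, ∀ P Q : X, P ≠ Q → P ∈ l → Q ∈ l → P ∈ l' → Q ∈ l' → l = l'

/-- The points `P, Q` and the points `P', Q'` lie on equal or disjoint lines of `L`. -/
def Parallel {X : Type*} (L : Set (Set X)) (P Q P' Q' : X) : Prop :=
  ∃ l ∈ L, ∃ l' ∈ L, P ∈ l ∧ Q ∈ l ∧ P' ∈ l' ∧ Q' ∈ l' ∧ (l = l' ∨ Disjoint l l')

/-! ### Pappus configurations in an abstract incidence structure. -/

namespace IsPappusConfiguration

section Incidence

variable {X : Type*} {L : Set (Set X)} {l₁ l₂ : Set X} {A₁ B₁ C₁ A₂ B₂ C₂ : X}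

theorem nodup_six (hA₁ : A₁ ∈ l₁ \ l₂) (hB₁ : B₁ ∈ l₁ \ l₂) (hC₁ : C₁ ∈ l₁ \ l₂)
    (hA₂ : A₂ ∈ l₂ \ l₁) (hB₂ : B₂ ∈ l₂ \ l₁) (hC₂ : C₂ ∈ l₂ \ l₁)
    (hAB₁ : A₁ ≠ B₁) (hAC₁ : A₁ ≠ C₁) (hBC₁ : B₁ ≠ C₁)
    (hAB₂ : A₂ ≠ B₂) (hAC₂ : A₂ ≠ C₂) (hBC₂ : B₂ ≠ C₂) :
    [A₁, B₁, C₁, A₂, B₂, C₂].Nodup := by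
  have key : ∀ {P Q : X}, P ∈ l₁ \ l₂ → Q ∈ l₂ \ l₁ → P ≠ Q := by
    rintro P Q hP hQ rfl
    exact hP.2 hQ.1
  simp [hAB₁, hAC₁, hBC₁, hAB₂, hAC₂, hBC₂, key hA₁ hA₂, key hA₁ hB₂, key hA₁ hC₂,
    key hB₁ hA₂, key hB₁ hB₂, key hB₁ hC₂, key hC₁ hA₂, key hC₁ hB₂, key hC₁ hC₂]

/-- The coincidence allowed by `Parallel` cannot occur here: a common line would contain two points
of `l₁`, hence equal `l₁`, yet it contains a point off `l₁`. -/
theorem of_parallel (hL : UniqueJoin L) (h₁ : l₁ ∈ L) (h₂ : l₂ ∈ L)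
    (hA₁ : A₁ ∈ l₁ \ l₂) (hB₁ : B₁ ∈ l₁ \ l₂) (hC₁ : C₁ ∈ l₁ \ l₂)
    (hA₂ : A₂ ∈ l₂ \ l₁) (hB₂ : B₂ ∈ l₂ \ l₁) (hC₂ : C₂ ∈ l₂ \ l₁)
    (hAB₁ : A₁ ≠ B₁) (hAC₁ : A₁ ≠ C₁) (hBC₁ : B₁ ≠ C₁)
    (hAB₂ : A₂ ≠ B₂) (hAC₂ : A₂ ≠ C₂) (hBC₂ : B₂ ≠ C₂)
    (pA : Parallel L B₁ C₂ C₁ B₂) (pB : Parallel L A₁ C₂ C₁ A₂) (pC : Parallel L A₁ B₂ B₁ A₂) :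
    IsPappusConfiguration L l₁ l₂ A₁ B₁ C₁ A₂ B₂ C₂ := by
  have key : ∀ {P Q P' Q' : X}, P ∈ l₁ → P' ∈ l₁ → P ≠ P' → Q ∉ l₁ → Parallel L P Q P' Q' →
      ∃ l ∈ L, ∃ l' ∈ L, P ∈ l ∧ Q ∈ l ∧ P' ∈ l' ∧ Q' ∈ l' ∧ Disjoint l l' := by
    rintro P Q P' Q' hP hP' hne hQ ⟨l, hl, l', hl', h1, h2, h3, h4, h | h⟩
    · subst h
      exact absurd h2 (hL l hl l₁ h₁ P P' hne h1 h3 hP hP' ▸ hQ)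
    · exact ⟨l, hl, l', hl', h1, h2, h3, h4, h⟩
  obtain ⟨a, ha, a', ha', a1, a2, a3, a4, da⟩ := key hB₁.1 hC₁.1 hBC₁ hC₂.2 pA
  obtain ⟨b, hb, b', hb', b1, b2, b3, b4, db⟩ := key hA₁.1 hC₁.1 hAC₁ hC₂.2 pB
  obtain ⟨c, hc, c', hc', c1, c2, c3, c4, dc⟩ := key hA₁.1 hB₁.1 hAB₁ hB₂.2 pC
  refine ⟨h₁, h₂, ?_, hA₁, hB₁, hC₁, hA₂, hB₂, hC₂, nodup_six hA₁ hB₁ hC₁ hA₂ hB₂ hC₂ hAB₁ hAC₁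
    hBC₁ hAB₂ hAC₂ hBC₂, a, a', b, b', c, c', ⟨ha, a1, a2⟩, ⟨ha', a4, a3⟩, ⟨hb, b1, b2⟩,
    ⟨hb', b4, b3⟩, ⟨hc, c1, c2⟩, ⟨hc', c4, c3⟩, Or.inr ⟨da, db, dc⟩⟩
  rintro rfl
  exact hA₁.2 hA₁.1

/-- For an affine Pappus configuration the distinctness of the nine points is automatic. -/
theorem of_collinear (hL : UniqueJoin L) (h₁ : l₁ ∈ L) (h₂ : l₂ ∈ L)
    (hA₁ : A₁ ∈ l₁ \ l₂) (hB₁ : B₁ ∈ l₁ \ l₂) (hC₁ : C₁ ∈ l₁ \ l₂)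
    (hA₂ : A₂ ∈ l₂ \ l₁) (hB₂ : B₂ ∈ l₂ \ l₁) (hC₂ : C₂ ∈ l₂ \ l₁)
    (hAB₁ : A₁ ≠ B₁) (hAC₁ : A₁ ≠ C₁) (hBC₁ : B₁ ≠ C₁)
    (hAB₂ : A₂ ≠ B₂) (hAC₂ : A₂ ≠ C₂) (hBC₂ : B₂ ≠ C₂)
    {a a' b b' c c' l₃ : Set X} {A₃ B₃ C₃ : X}
    (ha : IsLineThrough L B₁ C₂ a) (ha' : IsLineThrough L B₂ C₁ a')
    (hb : IsLineThrough L A₁ C₂ b) (hb' : IsLineThrough L A₂ C₁ b')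
    (hc : IsLineThrough L A₁ B₂ c) (hc' : IsLineThrough L A₂ B₁ c')
    (hA₃ : A₃ ∈ a ∩ a') (hB₃ : B₃ ∈ b ∩ b') (hC₃ : C₃ ∈ c ∩ c')
    (h₃ : l₃ ∈ L) (hA₃' : A₃ ∈ l₃) (hB₃' : B₃ ∈ l₃) (hC₃' : C₃ ∈ l₃) :
    IsPappusConfiguration L l₁ l₂ A₁ B₁ C₁ A₂ B₂ C₂ := by
  -- A diagonal point on one of the two base lines would have to equal the base points of both joins
  -- through it, which are distinct.
  have off : ∀ {l m : Set X}, l ∈ L → m ∈ L → ∀ {P P' Q Q' R : X} {g g' : Set X},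
      P ∈ l → P' ∈ l → P ≠ P' → Q ∉ l → Q' ∉ l → g ∈ L → P ∈ g → Q ∈ g → g' ∈ L → P' ∈ g' →
      Q' ∈ g' → R ∈ g → R ∈ g' → R ∉ l := by
    intro l m hl _ P P' Q Q' R g g' hP hP' hne hQ hQ' hg gP gQ hg' gP' gQ' gR gR' hR
    have e1 : R = P := by
      by_contra h
      exact hQ (hL g hg l hl R P h gR gP hR hP ▸ gQ)
    have e2 : R = P' := by
      by_contra h
      exact hQ' (hL g' hg' l hl R P' h gR' gP' hR hP' ▸ gQ')
    exact hne (e1.symm.trans e2)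
  have nA₁ : A₃ ∉ l₁ := off h₁ h₂ hB₁.1 hC₁.1 hBC₁ hC₂.2 hB₂.2 ha.1 ha.2.1 ha.2.2 ha'.1 ha'.2.2
    ha'.2.1 hA₃.1 hA₃.2
  have nB₁ : B₃ ∉ l₁ := off h₁ h₂ hA₁.1 hC₁.1 hAC₁ hC₂.2 hA₂.2 hb.1 hb.2.1 hb.2.2 hb'.1 hb'.2.2
    hb'.2.1 hB₃.1 hB₃.2
  have nC₁ : C₃ ∉ l₁ := off h₁ h₂ hA₁.1 hB₁.1 hAB₁ hB₂.2 hA₂.2 hc.1 hc.2.1 hc.2.2 hc'.1 hc'.2.2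
    hc'.2.1 hC₃.1 hC₃.2
  have nA₂ : A₃ ∉ l₂ := off h₂ h₁ hC₂.1 hB₂.1 hBC₂.symm hB₁.2 hC₁.2 ha.1 ha.2.2 ha.2.1 ha'.1
    ha'.2.1 ha'.2.2 hA₃.1 hA₃.2
  have nB₂ : B₃ ∉ l₂ := off h₂ h₁ hC₂.1 hA₂.1 hAC₂.symm hA₁.2 hC₁.2 hb.1 hb.2.2 hb.2.1 hb'.1
    hb'.2.1 hb'.2.2 hB₃.1 hB₃.2
  have nC₂ : C₃ ∉ l₂ := off h₂ h₁ hB₂.1 hA₂.1 hAB₂.symm hA₁.2 hB₁.2 hc.1 hc.2.2 hc.2.1 hc'.1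
    hc'.2.1 hc'.2.2 hC₃.1 hC₃.2
  -- Any two diagonal points lie on joins through a common point Q of `l₂`; if they coincided, the
  -- two joins would be one line, equal to `l₁` and containing Q.
  have dist : ∀ {P P' Q R R' : X} {g g' : Set X}, P ∈ l₁ → P' ∈ l₁ → P ≠ P' → Q ∈ l₂ \ l₁ →
      g ∈ L → g' ∈ L → P ∈ g → Q ∈ g → P' ∈ g' → Q ∈ g' → R ∈ g → R' ∈ g' → R ∉ l₂ → R ≠ R' := by
    rintro P P' Q R R' g g' hP hP' hne hQ hg hg' gP gQ gP' gQ' gR gR' hR rfl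
    have hRQ : R ≠ Q := fun h => hR (h ▸ hQ.1)
    have e := hL g hg g' hg' R Q hRQ gR gQ gR' gQ'
    subst e
    exact hQ.2 (hL g hg l₁ h₁ P P' hne gP gP' hP hP' ▸ gQ)
  have dAB : A₃ ≠ B₃ := dist hB₁.1 hA₁.1 hAB₁.symm hC₂ ha.1 hb.1 ha.2.1 ha.2.2 hb.2.1 hb.2.2
    hA₃.1 hB₃.1 nA₂
  have dAC : A₃ ≠ C₃ := dist hC₁.1 hA₁.1 hAC₁.symm hB₂ ha'.1 hc.1 ha'.2.2 ha'.2.1 hc.2.1 hc.2.2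
    hA₃.2 hC₃.1 nA₂
  have dBC : B₃ ≠ C₃ := dist hC₁.1 hB₁.1 hBC₁.symm hA₂ hb'.1 hc'.1 hb'.2.2 hb'.2.1 hc'.2.2 hc'.2.1
    hB₃.2 hC₃.2 nB₂
  have six := nodup_six hA₁ hB₁ hC₁ hA₂ hB₂ hC₂ hAB₁ hAC₁ hBC₁ hAB₂ hAC₂ hBC₂
  refine ⟨h₁, h₂, ?_, hA₁, hB₁, hC₁, hA₂, hB₂, hC₂, six, a, a', b, b', c, c', ha, ha', hb, hb', hc,
    hc', Or.inl ⟨A₃, B₃, C₃, hA₃, hB₃, hC₃, ?_, l₃, h₃, hA₃', hB₃', hC₃'⟩⟩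
  · rintro rfl
    exact hA₁.2 hA₁.1
  · have m : ∀ {P R : X} {l : Set X}, P ∈ l → R ∉ l → P ≠ R := fun hP hR h => hR (h ▸ hP)
    have : [A₁, B₁, C₁, A₂, B₂, C₂, A₃, B₃, C₃] = [A₁, B₁, C₁, A₂, B₂, C₂] ++ [A₃, B₃, C₃] := rfl
    rw [this, List.nodup_append]
    refine ⟨six, by simp [dAB, dAC, dBC], ?_⟩
    simp [m hA₁.1 nA₁, m hA₁.1 nB₁, m hA₁.1 nC₁, m hB₁.1 nA₁, m hB₁.1 nB₁, m hB₁.1 nC₁,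
      m hC₁.1 nA₁, m hC₁.1 nB₁, m hC₁.1 nC₁, m hA₂.1 nA₂, m hA₂.1 nB₂, m hA₂.1 nC₂,
      m hB₂.1 nA₂, m hB₂.1 nB₂, m hB₂.1 nC₂, m hC₂.1 nA₂, m hC₂.1 nB₂, m hC₂.1 nC₂]

/-- Together with `swap_BC` this gives all simultaneous permutations of the letters, so a case
distinction may single out any pair of the given points. -/
theorem swap_AB (h : IsPappusConfiguration L l₁ l₂ A₁ B₁ C₁ A₂ B₂ C₂) :
    IsPappusConfiguration L l₁ l₂ B₁ A₁ C₁ B₂ A₂ C₂ := by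
  obtain ⟨h₁, h₂, hne, hA₁, hB₁, hC₁, hA₂, hB₂, hC₂, six, a, a', b, b', c, c', ha, ha', hb, hb', hc,
    hc', h⟩ := h
  refine ⟨h₁, h₂, hne, hB₁, hA₁, hC₁, hB₂, hA₂, hC₂, six.perm ((List.Perm.swap _ _ _).trans
      (((((List.Perm.swap _ _ _)).cons _).cons _).cons _)), b, b', a, a', c', c,
    hb, hb', ha, ha', ⟨hc'.1, hc'.2.2, hc'.2.1⟩, ⟨hc.1, hc.2.2, hc.2.1⟩, ?_⟩
  rcases h with ⟨A₃, B₃, C₃, hA₃, hB₃, hC₃, hn, l₃, h₃, h⟩ | ⟨da, db, dc⟩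
  · exact Or.inl ⟨B₃, A₃, C₃, hB₃, hA₃, hC₃.symm, hn.perm ((List.Perm.swap _ _ _).trans
      (((((List.Perm.swap _ _ _).trans
        ((((List.Perm.swap _ _ _).cons _).cons _).cons _)).cons _).cons _).cons _)), l₃, h₃, h.2.1,
      h.1, h.2.2⟩
  · exact Or.inr ⟨db, da, dc.symm⟩

theorem swap_BC (h : IsPappusConfiguration L l₁ l₂ A₁ B₁ C₁ A₂ B₂ C₂) :
    IsPappusConfiguration L l₁ l₂ A₁ C₁ B₁ A₂ C₂ B₂ := by
  obtain ⟨h₁, h₂, hne, hA₁, hB₁, hC₁, hA₂, hB₂, hC₂, six, a, a', b, b', c, c', ha, ha', hb, hb', hc,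
    hc', h⟩ := h
  refine ⟨h₁, h₂, hne, hA₁, hC₁, hB₁, hA₂, hC₂, hB₂, six.perm (((List.Perm.swap _ _ _).trans
      ((((List.Perm.swap _ _ _).cons _).cons _).cons _)).cons _), a', a, c, c', b, b',
    ⟨ha'.1, ha'.2.2, ha'.2.1⟩, ⟨ha.1, ha.2.2, ha.2.1⟩, hc, hc', hb, hb', ?_⟩
  rcases h with ⟨A₃, B₃, C₃, hA₃, hB₃, hC₃, hn, l₃, h₃, h⟩ | ⟨da, db, dc⟩
  · exact Or.inl ⟨A₃, C₃, B₃, hA₃.symm, hC₃, hB₃, hn.perm (((List.Perm.swap _ _ _).trans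
      (((((List.Perm.swap _ _ _).trans
        ((((List.Perm.swap _ _ _).cons _).cons _).cons _)).cons _).cons _).cons _)).cons _), l₃, h₃,
      h.1, h.2.2, h.2.1⟩
  · exact Or.inr ⟨da.symm, dc, db⟩

theorem map {Y : Type*} {L' : Set (Set Y)} (e : X ≃ Y) (he : ∀ l ∈ L, e '' l ∈ L')
    (h : IsPappusConfiguration L l₁ l₂ A₁ B₁ C₁ A₂ B₂ C₂) :
    IsPappusConfiguration L' (e '' l₁) (e '' l₂) (e A₁) (e B₁) (e C₁) (e A₂) (e B₂) (e C₂) := by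
  have md : ∀ {P : X} {l m : Set X}, P ∈ l \ m → e P ∈ (e '' l) \ (e '' m) := by
    rintro P l m ⟨h1, h2⟩
    exact ⟨⟨P, h1, rfl⟩, fun h => h2 ((e.injective.mem_set_image).1 h)⟩
  have ml : ∀ {P Q : X} {l : Set X}, IsLineThrough L P Q l →
      IsLineThrough L' (e P) (e Q) (e '' l) := by
    rintro P Q l ⟨h1, h2, h3⟩
    exact ⟨he l h1, ⟨P, h2, rfl⟩, ⟨Q, h3, rfl⟩⟩
  have mi : ∀ {P : X} {l m : Set X}, P ∈ l ∩ m → e P ∈ (e '' l) ∩ (e '' m) := by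
    rintro P l m ⟨h1, h2⟩
    exact ⟨⟨P, h1, rfl⟩, ⟨P, h2, rfl⟩⟩
  obtain ⟨h₁, h₂, hne, hA₁, hB₁, hC₁, hA₂, hB₂, hC₂, six, a, a', b, b', c, c', ha, ha', hb, hb', hc,
    hc', h⟩ := h
  refine ⟨he _ h₁, he _ h₂, fun h => hne (e.injective.image_injective h), md hA₁, md hB₁, md hC₁,
    md hA₂, md hB₂, md hC₂, six.map e.injective, _, _, _, _, _, _, ml ha, ml ha', ml hb, ml hb',
    ml hc, ml hc', ?_⟩
  rcases h with ⟨A₃, B₃, C₃, hA₃, hB₃, hC₃, hn, l₃, h₃, h⟩ | ⟨da, db, dc⟩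
  · exact Or.inl ⟨e A₃, e B₃, e C₃, mi hA₃, mi hB₃, mi hC₃, hn.map e.injective, _, he _ h₃,
      ⟨_, h.1, rfl⟩, ⟨_, h.2.1, rfl⟩, ⟨_, h.2.2, rfl⟩⟩
  · exact Or.inr ⟨(Set.disjoint_image_iff e.injective).2 da,
      (Set.disjoint_image_iff e.injective).2 db, (Set.disjoint_image_iff e.injective).2 dc⟩

/-- An involution `τ` with the axis `m` takes `A, B, C` on `l` to three points of `τ(l)`; the lines
joining `P` to `τ Q` and `Q` to `τ P` meet on the axis. The nine points can be read as a Pappus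
configuration on `l` and the axis, or on `l` and `τ(l)`. -/
theorem of_involution (hL : UniqueJoin L) {τ : X → X} (hττ : ∀ P, τ (τ P) = P)
    (hτ : ∀ l ∈ L, τ '' l ∈ L) {l m : Set X} (hl : l ∈ L) (hm : m ∈ L) (hfix : ∀ P ∈ m, τ P = P)
    {A B C : X} (hA : A ∈ l \ m) (hB : B ∈ l \ m) (hC : C ∈ l \ m)
    (hA' : A ∉ τ '' l) (hB' : B ∉ τ '' l) (hC' : C ∉ τ '' l)
    (hAB : A ≠ B) (hAC : A ≠ C) (hBC : B ≠ C)
    (jAB : ∃ g ∈ L, A ∈ g ∧ τ B ∈ g ∧ ∃ X ∈ g, X ∈ m)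
    (jAC : ∃ g ∈ L, A ∈ g ∧ τ C ∈ g ∧ ∃ X ∈ g, X ∈ m)
    (jBC : ∃ g ∈ L, B ∈ g ∧ τ C ∈ g ∧ ∃ X ∈ g, X ∈ m) :
    (∃ A₂ B₂ C₂, IsPappusConfiguration L l m A B C A₂ B₂ C₂) ∧
      IsPappusConfiguration L l (τ '' l) A B C (τ A) (τ B) (τ C) := by
  have τinj : Function.Injective τ := fun P Q h => by rw [← hττ P, h, hττ]
  have hl' := hτ l hl
  have img : ∀ {P : X} {g : Set X}, P ∈ g → τ P ∈ τ '' g := fun h => ⟨_, h, rfl⟩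
  have img' : ∀ {P : X} {g : Set X}, τ P ∈ g → P ∈ τ '' g := fun {P g} h => ⟨_, h, hττ P⟩
  have notl : ∀ {P : X}, P ∉ τ '' l → τ P ∉ l := fun h h' => h (img' h')
  have notm : ∀ {P : X}, P ∉ m → τ P ∉ m := fun {P} h h' => h (by
    have := hfix _ h'
    rw [hττ] at this
    rwa [this])
  obtain ⟨gC, hgC, C1, C2, XC, XCg, XCm⟩ := jAB
  obtain ⟨gB, hgB, B1, B2, XB, XBg, XBm⟩ := jAC
  obtain ⟨gA, hgA, A1, A2, XA, XAg, XAm⟩ := jBC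
  have off : ∀ {P Q Y : X} {g : Set X}, P ∈ l \ m → Q ∈ l \ m → P ∉ τ '' l → Q ∉ τ '' l → g ∈ L →
      P ∈ g → τ Q ∈ g → Y ∈ g → Y ∈ m → Y ∉ l := by
    intro P Q Y g hP hQ hP' hQ' hg gP gQ gY hY hYl
    have : Y ≠ P := fun h => hP.2 (h ▸ hY)
    exact notl hQ' (hL g hg l hl Y P this gY gP hYl hP.1 ▸ gQ)
  have onτ : ∀ {Y : X} {g : Set X}, Y ∈ g → Y ∈ m → Y ∈ τ '' g := by
    intro Y g hY hYm
    have := img hY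
    rwa [hfix Y hYm] at this
  have XAl := off hB hC hB' hC' hgA A1 A2 XAg XAm
  have XBl := off hA hC hA' hC' hgB B1 B2 XBg XBm
  have XCl := off hA hB hA' hB' hgC C1 C2 XCg XCm
  have dist : ∀ {P Q R Y : X} {g g' : Set X}, P ∈ l → Q ∈ l → P ≠ Q → R ∉ m → R ∉ τ '' l → g ∈ L →
      g' ∈ L → P ∈ g → τ R ∈ g → Q ∈ g' → τ R ∈ g' → Y ∈ g → Y ∈ g' → Y ∈ m → False := by
    intro P Q R Y g g' hP hQ hne hR hR' hg hg' gP gR gQ gR' gY gY' hY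
    have : Y ≠ τ R := fun h => notm hR (h ▸ hY)
    have e := hL g hg g' hg' Y (τ R) this gY gR gY' gR'
    subst e
    exact notl hR' (hL g hg l hl P Q hne gP gQ hP hQ ▸ gR)
  have dAB : XA ≠ XB := by
    rintro rfl
    exact dist hB.1 hA.1 hAB.symm hC.2 hC' hgA hgB A1 A2 B1 B2 XAg XBg XAm
  have dAC : XA ≠ XC := by
    rintro rfl
    exact dist hC.1 hA.1 hAC.symm hB.2 hB' (hτ _ hgA) hgC (img' A2) (img A1) C1 C2 (onτ XAg XAm)
      XCg XAm
  have dBC : XB ≠ XC := by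
    rintro rfl
    exact dist hC.1 hB.1 hBC.symm hA.2 hA' (hτ _ hgB) (hτ _ hgC) (img' B2) (img B1) (img' C2)
      (img C1) (onτ XBg XBm) (onτ XCg XBm) XBm
  constructor
  -- First reading: the axis points are the second triple, and `τ A`, `τ B`, `τ C` are the diagonal
  -- points on the Pappus line `τ '' l`. The joins are the lines g and their images, because τ fixes
  -- the axis pointwise.
  · exact ⟨XA, XB, XC, of_collinear hL hl hm hA hB hC ⟨XAm, XAl⟩ ⟨XBm, XBl⟩ ⟨XCm, XCl⟩ hAB hAC hBC
      dAB dAC dBC (a := τ '' gC) (a' := τ '' gB) (b := gC) (b' := τ '' gA) (c := gB) (c' := gA)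
      (A₃ := τ A) (B₃ := τ B) (C₃ := τ C) ⟨hτ _ hgC, img' C2, onτ XCg XCm⟩
      ⟨hτ _ hgB, onτ XBg XBm, img' B2⟩ ⟨hgC, C1, XCg⟩ ⟨hτ _ hgA, onτ XAg XAm, img' A2⟩
      ⟨hgB, B1, XBg⟩ ⟨hgA, XAg, A1⟩ ⟨img C1, img B1⟩ ⟨C2, img A1⟩ ⟨B2, A2⟩ hl' (img hA.1)
      (img hB.1) (img hC.1)⟩
  -- Second reading: each pair of joins is a line g and its image, and the axis is the Pappus line.
  · exact of_collinear hL hl hl' ⟨hA.1, hA'⟩ ⟨hB.1, hB'⟩ ⟨hC.1, hC'⟩ ⟨img hA.1, notl hA'⟩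
      ⟨img hB.1, notl hB'⟩ ⟨img hC.1, notl hC'⟩ hAB hAC hBC (τinj.ne hAB) (τinj.ne hAC) (τinj.ne hBC)
      (a := gA) (a' := τ '' gA) (b := gB) (b' := τ '' gB) (c := gC) (c' := τ '' gC)
      ⟨hgA, A1, A2⟩ ⟨hτ _ hgA, img A1, img' A2⟩ ⟨hgB, B1, B2⟩ ⟨hτ _ hgB, img B1, img' B2⟩
      ⟨hgC, C1, C2⟩ ⟨hτ _ hgC, img C1, img' C2⟩ ⟨XAg, onτ XAg XAm⟩ ⟨XBg, onτ XBg XBm⟩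
      ⟨XCg, onτ XCg XCm⟩ hm XAm XBm XCm

end Incidence

end IsPappusConfiguration

/-! ### The derived model of the Hall plane on K × K. -/

namespace HallModel

variable {K : Type*} [Field K]

/-- The determinant of two vectors of `K × K`. -/
def wedge (v w : K × K) : K := v.1 * w.2 - v.2 * w.1

/-- Componentwise conjugation on `K × K`. -/
def bar (σ : K →+* K) (v : K × K) : K × K := (σ v.1, σ v.2)

/-- The `K`-line through `v₀` with direction `d`. -/
def desLine (v₀ d : K × K) : Set (K × K) := {v | wedge (v - v₀) d = 0}

/-- The translate by `v₀` of the `e`-multiples of the vectors fixed by conjugation. -/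
def baerLine (σ : K →+* K) (v₀ : K × K) (e : K) : Set (K × K) :=
  {v | e • bar σ (v - v₀) = σ e • (v - v₀)}

/-- The lines of the Hall plane in its representation on `K × K`: the affine plane over `K`, with
the lines of the directions that are fixed by conjugation replaced by Baer subplanes. -/
def lines (σ : K →+* K) : Set (Set (K × K)) :=
  {l | (∃ v d, wedge d (bar σ d) ≠ 0 ∧ l = desLine v d) ∨ ∃ v e, e ≠ 0 ∧ l = baerLine σ v e}

variable {σ : K →+* K}

theorem mem_desLine {v v₀ d : K × K} :
    v ∈ desLine v₀ d ↔ (v.1 - v₀.1) * d.2 - (v.2 - v₀.2) * d.1 = 0 := Iff.rfl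

theorem mem_baerLine {v v₀ : K × K} {e : K} : v ∈ baerLine σ v₀ e ↔
    e * (σ v.1 - σ v₀.1) = σ e * (v.1 - v₀.1) ∧ e * (σ v.2 - σ v₀.2) = σ e * (v.2 - v₀.2) := by
  simp [baerLine, bar, Prod.ext_iff]

theorem desLine_mem {v d : K × K} (hd : wedge d (bar σ d) ≠ 0) : desLine v d ∈ lines σ :=
  Or.inl ⟨v, d, hd, rfl⟩

theorem baerLine_mem {v : K × K} {e : K} (he : e ≠ 0) : baerLine σ v e ∈ lines σ :=
  Or.inr ⟨v, e, he, rfl⟩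

theorem base_mem_desLine (v d : K × K) : v ∈ desLine v d := by simp [mem_desLine]

theorem base_mem_baerLine (v : K × K) (e : K) : v ∈ baerLine σ v e := by simp [mem_baerLine]

theorem ne_zero_of_wedge {d w : K × K} (h : wedge d w ≠ 0) : d.1 ≠ 0 ∨ d.2 ≠ 0 := by
  by_contra! h'
  exact h (by simp [wedge, h'.1, h'.2])

theorem desLine_eq {v₀ d P w : K × K} (hP : P ∈ desLine v₀ d) (hd : d.1 ≠ 0 ∨ d.2 ≠ 0)
    (hw : w.1 ≠ 0 ∨ w.2 ≠ 0) (h : wedge w d = 0) : desLine v₀ d = desLine P w := by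
  rw [mem_desLine] at hP
  simp only [wedge] at h
  ext v
  rw [mem_desLine, mem_desLine]
  constructor <;> intro hv
  · rcases hd with hd | hd
    · apply mul_left_cancel₀ hd
      linear_combination w.1 * hv - w.1 * hP - (v.1 - P.1) * h
    · apply mul_left_cancel₀ hd
      linear_combination w.2 * hv - w.2 * hP - (v.2 - P.2) * h
  · rcases hw with hw | hw
    · apply mul_left_cancel₀ hw
      linear_combination d.1 * hv + w.1 * hP + (v.1 - P.1) * h
    · apply mul_left_cancel₀ hw
      linear_combination d.2 * hv + w.2 * hP + (v.2 - P.2) * h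

theorem baerLine_eq {v₀ P : K × K} {e e' : K} (hP : P ∈ baerLine σ v₀ e) (he : e ≠ 0)
    (he' : e' ≠ 0) (h : e * σ e' = σ e * e') : baerLine σ v₀ e = baerLine σ P e' := by
  rw [mem_baerLine] at hP
  ext v
  rw [mem_baerLine, mem_baerLine]
  constructor <;> rintro ⟨h1, h2⟩
  · constructor <;> apply mul_left_cancel₀ he
    · linear_combination e' * h1 - e' * hP.1 - (v.1 - P.1) * h
    · linear_combination e' * h2 - e' * hP.2 - (v.2 - P.2) * h
  · constructor <;> apply mul_left_cancel₀ he'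
    · linear_combination e * h1 + e' * hP.1 + (v.1 - P.1) * h
    · linear_combination e * h2 + e' * hP.2 + (v.2 - P.2) * h

/-- A vector proportional to its conjugate becomes real after division by a nonzero coordinate, and
that coordinate is the multiplier. -/
theorem exists_baer_direction {w : K × K} (hw : w.1 ≠ 0 ∨ w.2 ≠ 0) (h : wedge w (bar σ w) = 0) :
    ∃ e ≠ 0, e * σ w.1 = σ e * w.1 ∧ e * σ w.2 = σ e * w.2 := by
  simp only [wedge, bar] at h
  rcases hw with hw | hw
  · exact ⟨w.1, hw, by ring, by linear_combination h⟩
  · exact ⟨w.2, hw, by linear_combination -h, by ring⟩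

theorem wedge_bar_eq_zero {w : K × K} {e : K} (he : e ≠ 0) (h1 : e * σ w.1 = σ e * w.1)
    (h2 : e * σ w.2 = σ e * w.2) : wedge w (bar σ w) = 0 := by
  simp only [wedge, bar]
  apply mul_left_cancel₀ he
  linear_combination w.1 * h2 - w.2 * h1

/-- Rescaling d by t multiplies the determinant by t σ(t), so being non-real is a property of the
K-direction. -/
theorem wedge_bar_ne_zero {d w : K × K} (hd : wedge d (bar σ d) ≠ 0) (hw : w.1 ≠ 0 ∨ w.2 ≠ 0)
    (h : wedge w d = 0) : wedge w (bar σ w) ≠ 0 := by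
  simp only [wedge, bar] at *
  have h' : σ w.1 * σ d.2 - σ w.2 * σ d.1 = 0 := by
    rw [← map_mul, ← map_mul, ← map_sub, h, map_zero]
  intro h0
  rcases hw with hw | hw
  · have hs : σ w.1 ≠ 0 := (map_ne_zero σ).2 hw
    apply hd
    apply mul_left_cancel₀ (mul_ne_zero hw hs)
    linear_combination d.1 * w.1 * h' - d.1 * σ d.1 * (-h0) - σ w.1 * σ d.1 * h
  · have hs : σ w.2 ≠ 0 := (map_ne_zero σ).2 hw
    apply hd
    apply mul_left_cancel₀ (mul_ne_zero hw hs)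
    linear_combination w.2 * d.2 * h' + d.2 * σ d.2 * h0 - σ w.2 * σ d.2 * h

theorem sub_coord_ne {P Q : K × K} (h : P ≠ Q) : (Q - P).1 ≠ 0 ∨ (Q - P).2 ≠ 0 := by
  by_contra! h'
  exact h (Prod.ext (sub_eq_zero.1 h'.1).symm (sub_eq_zero.1 h'.2).symm)

theorem exists_line_through {P Q : K × K} (h : P ≠ Q) : ∃ l ∈ lines σ, P ∈ l ∧ Q ∈ l := by
  by_cases hw : wedge (Q - P) (bar σ (Q - P)) = 0
  · obtain ⟨e, he, h1, h2⟩ := exists_baer_direction (sub_coord_ne h) hw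
    refine ⟨baerLine σ P e, baerLine_mem he, base_mem_baerLine P e, ?_⟩
    simp only [Prod.fst_sub, Prod.snd_sub, map_sub] at h1 h2
    exact mem_baerLine.2 ⟨h1, h2⟩
  · refine ⟨desLine P (Q - P), desLine_mem hw, base_mem_desLine _ _, ?_⟩
    simp only [mem_desLine, Prod.fst_sub, Prod.snd_sub]
    ring

/-- The difference of the two points determines the line. It cannot serve both types at once, since
a multiple of a real vector is proportional to its conjugate. -/
theorem uniqueJoin : UniqueJoin (lines σ) := by
  have db : ∀ {v d v' : K × K} {e : K} {P Q : K × K}, wedge d (bar σ d) ≠ 0 → e ≠ 0 → P ≠ Q →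
      P ∈ desLine v d → Q ∈ desLine v d → P ∈ baerLine σ v' e → Q ∈ baerLine σ v' e → False := by
    intro v d v' e P Q hd he hne hP hQ hP' hQ'
    rw [mem_desLine] at hP hQ
    rw [mem_baerLine] at hP' hQ'
    refine wedge_bar_ne_zero hd (sub_coord_ne hne) ?_
      (wedge_bar_eq_zero he (w := Q - P) ?_ ?_)
    · simp only [wedge, Prod.fst_sub, Prod.snd_sub]
      linear_combination hQ - hP
    · simp only [Prod.fst_sub, map_sub]
      linear_combination hQ'.1 - hP'.1
    · simp only [Prod.snd_sub, map_sub]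
      linear_combination hQ'.2 - hP'.2
  rintro l (⟨v, d, hd, rfl⟩ | ⟨v, e, he, rfl⟩) l' (⟨v', d', hd', rfl⟩ | ⟨v', e', he', rfl⟩) P Q hne
    hP hQ hP' hQ'
  · have hw := sub_coord_ne hne
    have key : ∀ {v d : K × K}, wedge d (bar σ d) ≠ 0 → P ∈ desLine v d → Q ∈ desLine v d →
        desLine v d = desLine P (Q - P) := by
      intro v d hd hP hQ
      refine desLine_eq hP (ne_zero_of_wedge hd) hw ?_
      rw [mem_desLine] at hP hQ
      simp only [wedge, Prod.fst_sub, Prod.snd_sub]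
      linear_combination hQ - hP
    rw [key hd hP hQ, key hd' hP' hQ']
  · exact (db hd he' hne hP hQ hP' hQ').elim
  · exact (db hd' he hne hP' hQ' hP hQ).elim
  · refine (baerLine_eq hP he he' ?_).trans (baerLine_eq hP' he' he' (mul_comm _ _)).symm
    have hw := sub_coord_ne hne
    rw [mem_baerLine] at hP hQ hP' hQ'
    rcases hw with hw | hw
    · apply mul_left_cancel₀ hw
      simp only [Prod.fst_sub]
      linear_combination e' * (hQ.1 - hP.1) - e * (hQ'.1 - hP'.1)
    · apply mul_left_cancel₀ hw
      simp only [Prod.snd_sub]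
      linear_combination e' * (hQ.2 - hP.2) - e * (hQ'.2 - hP'.2)

/-! ### Intersection of non-parallel lines. -/

section Meet

theorem desLine_meet_desLine {v d v' d' : K × K} (h : wedge d d' ≠ 0) :
    ∃ X ∈ desLine v d, X ∈ desLine v' d' := by
  obtain ⟨t, ht⟩ : ∃ t, t * wedge d d' = -wedge (v - v') d' :=
    ⟨-wedge (v - v') d' / wedge d d', by field_simp⟩
  refine ⟨v + t • d, ?_, ?_⟩
  · simp [mem_desLine]
    ring
  · simp only [wedge, Prod.fst_sub, Prod.snd_sub] at ht
    simp only [mem_desLine, Prod.fst_add, Prod.snd_add, Prod.smul_fst, Prod.smul_snd, smul_eq_mul]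
    linear_combination ht

theorem desLine_meet_baerLine (hσ : Function.Involutive σ) {v d v' : K × K} {e : K}
    (hd : wedge d (bar σ d) ≠ 0) (he : e ≠ 0) : ∃ X ∈ desLine v d, X ∈ baerLine σ v' e := by
  have hs : σ e ≠ 0 := (map_ne_zero σ).2 he
  obtain ⟨u, rfl⟩ : ∃ u, v = u + v' := ⟨v - v', by simp⟩
  -- For u + t d to lie in eF² one needs e σ(u + t d) = σ(e)(u + t d). Taking the determinant with
  -- the conjugate of d removes σ(t) and leaves this linear equation for t; it and its conjugate
  -- give back both coordinates.
  obtain ⟨t, ht⟩ : ∃ t, t * (σ e * wedge d (bar σ d)) =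
      e * wedge (bar σ u) (bar σ d) - σ e * wedge u (bar σ d) :=
    ⟨_, div_mul_cancel₀ _ (mul_ne_zero hs hd)⟩
  have ht' := congrArg σ ht
  simp only [wedge, bar, map_mul, map_sub, hσ _] at ht ht' hd
  refine ⟨u + v' + t • d, ?_, ?_⟩
  · simp [mem_desLine]
    ring
  · simp only [mem_baerLine, Prod.fst_add, Prod.snd_add, Prod.smul_fst, Prod.smul_snd, smul_eq_mul,
      map_add, map_mul]
    constructor <;> apply mul_left_cancel₀ hd
    · linear_combination -d.1 * ht - σ d.1 * ht'
    · linear_combination -d.2 * ht - σ d.2 * ht'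

theorem baerLine_meet_baerLine (hσ : Function.Involutive σ) {v v' : K × K} {e e' : K}
    (h : e * σ e' ≠ σ e * e') : ∃ X ∈ baerLine σ v e, X ∈ baerLine σ v' e' := by
  obtain ⟨u, rfl⟩ : ∃ u, v = u + v' := ⟨v - v', by simp⟩
  have hD : σ e * e' - e * σ e' ≠ 0 := sub_ne_zero.2 h.symm
  have key : ∀ x : K, ∃ f, σ f = f ∧ f * (σ e * e' - e * σ e') = σ e * x - e * σ x := by
    intro x
    have hD' : e * σ e' - σ e * e' ≠ 0 := sub_ne_zero.2 h
    -- Numerator and denominator both change sign under σ, so the quotient is fixed.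
    refine ⟨(σ e * x - e * σ x) / (σ e * e' - e * σ e'), ?_, div_mul_cancel₀ _ hD⟩
    simp only [map_div₀, map_sub, map_mul, hσ _]
    field_simp
    ring
  obtain ⟨f, hf, hf'⟩ := key u.1
  obtain ⟨g, hg, hg'⟩ := key u.2
  refine ⟨v' + (e' * f, e' * g), ?_, ?_⟩
  · simp only [mem_baerLine, Prod.fst_add, Prod.snd_add, map_add, map_mul, hf, hg]
    constructor
    · linear_combination -hf'
    · linear_combination -hg'
  · simp only [mem_baerLine, Prod.fst_add, Prod.snd_add, map_add, map_mul, hf, hg]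
    constructor <;> ring

/-- A line of the plane meets every line that is not parallel to it. -/
theorem exists_meet (hσ : Function.Involutive σ) {l m : Set (K × K)} (hl : l ∈ lines σ)
    (hm : m ∈ lines σ) (h0 : 0 ∈ m) {P Q : K × K} (hP : P ∈ l) (hQ : Q ∈ l) (h : Q - P ∉ m) :
    ∃ X ∈ l, X ∈ m := by
  have hne : P ≠ Q := by
    rintro rfl
    exact h (by simpa using h0)
  have hw := sub_coord_ne hne
  rcases hl with ⟨v, d, hd, rfl⟩ | ⟨v, e, he, rfl⟩ <;>
    rcases hm with ⟨v', d', hd', rfl⟩ | ⟨v', e', he', rfl⟩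
  · apply desLine_meet_desLine
    intro h'
    apply h
    rw [desLine_eq h0 (ne_zero_of_wedge hd') (ne_zero_of_wedge hd) h', mem_desLine]
    rw [mem_desLine] at hP hQ
    simp only [Prod.fst_sub, Prod.snd_sub, Prod.fst_zero, Prod.snd_zero]
    linear_combination hQ - hP
  · exact desLine_meet_baerLine hσ hd he'
  · obtain ⟨X, h1, h2⟩ := desLine_meet_baerLine hσ (v := v') (v' := v) hd' he
    exact ⟨X, h2, h1⟩
  · apply baerLine_meet_baerLine hσ
    intro h'
    apply h
    rw [baerLine_eq h0 he' he (by linear_combination -h'), mem_baerLine]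
    rw [mem_baerLine] at hP hQ
    simp only [Prod.fst_sub, Prod.snd_sub, Prod.fst_zero, Prod.snd_zero, map_sub, map_zero]
    exact ⟨by linear_combination hQ.1 - hP.1, by linear_combination hQ.2 - hP.2⟩

end Meet

/-! ### Criteria for parallel joins. -/

section Parallel

theorem desLine_eq_or_disjoint (P P' d : K × K) :
    desLine P d = desLine P' d ∨ Disjoint (desLine P d) (desLine P' d) := by
  by_cases h : wedge P d = wedge P' d
  · left
    simp only [wedge] at h
    ext v
    rw [mem_desLine, mem_desLine]
    constructor <;> intro hv
    · linear_combination hv + h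
    · linear_combination hv - h
  · right
    rw [Set.disjoint_left]
    intro v h1 h2
    apply h
    rw [mem_desLine] at h1 h2
    simp only [wedge]
    linear_combination h2 - h1

theorem baerLine_eq_or_disjoint (P P' : K × K) {e : K} (he : e ≠ 0) :
    baerLine σ P e = baerLine σ P' e ∨ Disjoint (baerLine σ P e) (baerLine σ P' e) := by
  by_cases h : P' ∈ baerLine σ P e
  · exact Or.inl (baerLine_eq h he he (mul_comm _ _))
  · right
    rw [Set.disjoint_left]
    intro v h1 h2
    apply h
    rw [mem_baerLine] at *
    exact ⟨by linear_combination h1.1 - h2.1, by linear_combination h1.2 - h2.2⟩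

theorem parallel_of_desLine {P Q P' Q' d : K × K} (hd : wedge d (bar σ d) ≠ 0)
    (h : wedge (Q - P) d = 0) (h' : wedge (Q' - P') d = 0) : Parallel (lines σ) P Q P' Q' :=
  ⟨desLine P d, desLine_mem hd, desLine P' d, desLine_mem hd, base_mem_desLine _ _, h,
    base_mem_desLine _ _, h', desLine_eq_or_disjoint P P' d⟩

theorem parallel_of_baerLine {P Q P' Q' : K × K} {e : K} (he : e ≠ 0)
    (h : e • bar σ (Q - P) = σ e • (Q - P)) (h' : e • bar σ (Q' - P') = σ e • (Q' - P')) :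
    Parallel (lines σ) P Q P' Q' :=
  ⟨baerLine σ P e, baerLine_mem he, baerLine σ P' e, baerLine_mem he, base_mem_baerLine _ _, h,
    base_mem_baerLine _ _, h', baerLine_eq_or_disjoint P P' he⟩

/-- A factor fixed by σ preserves both kinds of direction, so the type of the join need not be
known. -/
theorem parallel_of_smul {P Q P' Q' : K × K} {k : K} (hk : σ k = k) (hne : P ≠ Q)
    (h : Q' - P' = k • (Q - P)) : Parallel (lines σ) P Q P' Q' := by
  by_cases hw : wedge (Q - P) (bar σ (Q - P)) = 0
  · obtain ⟨e, he, h1, h2⟩ := exists_baer_direction (sub_coord_ne hne) hw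
    refine parallel_of_baerLine he (Prod.ext h1 h2) ?_
    rw [h]
    refine Prod.ext ?_ ?_ <;>
      simp only [bar, Prod.smul_fst, Prod.smul_snd, smul_eq_mul, map_mul, hk]
    · linear_combination k * h1
    · linear_combination k * h2
  · refine parallel_of_desLine hw ?_ ?_
    · simp only [wedge]; ring
    · rw [h]
      simp only [wedge, Prod.smul_fst, Prod.smul_snd, smul_eq_mul]; ring

end Parallel

end HallModel

namespace HallModel

variable {K : Type*} [Field K] {σ : K →+* K}

theorem bar_eq_self_iff {a : K × K} : bar σ a = a ↔ σ a.1 = a.1 ∧ σ a.2 = a.2 := by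
  simp [bar, Prod.ext_iff]

theorem mem_desLine_zero {x d : K × K} (hd : d.1 ≠ 0 ∨ d.2 ≠ 0) :
    x ∈ desLine 0 d ↔ ∃ a : K, x = a • d := by
  simp only [mem_desLine, Prod.fst_zero, Prod.snd_zero, sub_zero]
  constructor
  · intro h
    rcases hd with hd | hd
    · refine ⟨x.1 / d.1, Prod.ext ?_ ?_⟩
      · simp [div_mul_cancel₀ _ hd]
      · simp only [Prod.smul_snd, smul_eq_mul]
        field_simp
        linear_combination -h
    · refine ⟨x.2 / d.2, Prod.ext ?_ ?_⟩
      · simp only [Prod.smul_fst, smul_eq_mul]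
        field_simp
        linear_combination h
      · simp [div_mul_cancel₀ _ hd]
  · rintro ⟨a, rfl⟩
    simp
    ring

theorem mem_baerLine_zero {x : K × K} {e : K} (he : e ≠ 0) :
    x ∈ baerLine σ 0 e ↔ ∃ a : K × K, bar σ a = a ∧ x = e • a := by
  have hs : σ e ≠ 0 := (map_ne_zero σ).2 he
  simp only [mem_baerLine, Prod.fst_zero, Prod.snd_zero, sub_zero, map_zero]
  constructor
  · rintro ⟨h1, h2⟩
    refine ⟨e⁻¹ • x, ?_, ?_⟩
    · refine Prod.ext ?_ ?_ <;> simp only [bar, Prod.smul_fst, Prod.smul_snd, smul_eq_mul, map_mul,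
        map_inv₀] <;> field_simp
      · linear_combination h1
      · linear_combination h2
    · rw [smul_smul, mul_inv_cancel₀ he, one_smul]
  · rintro ⟨a, ha, rfl⟩
    rw [bar_eq_self_iff] at ha
    simp only [Prod.smul_fst, Prod.smul_snd, smul_eq_mul, map_mul, ha.1, ha.2]
    exact ⟨by ring, by ring⟩

theorem isLineThrough_desLine {P Q : K × K} (h : wedge (Q - P) (bar σ (Q - P)) ≠ 0) :
    IsLineThrough (lines σ) P Q (desLine P (Q - P)) := by
  refine ⟨desLine_mem h, base_mem_desLine _ _, ?_⟩
  simp only [mem_desLine, Prod.fst_sub, Prod.snd_sub]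
  ring

theorem coord_ne_of_ne_zero {a : K × K} (h : a ≠ 0) : a.1 ≠ 0 ∨ a.2 ≠ 0 := by
  by_contra! h'
  exact h (Prod.ext h'.1 h'.2)

/-! ### Two Baer lines through the origin. -/

section TwoBaerLines

theorem smul_mem_diff {e₁ e₂ : K} (he₁ : e₁ ≠ 0) (h : e₁ * σ e₂ ≠ σ e₁ * e₂) {a : K × K}
    (ha : bar σ a = a) (ha0 : a ≠ 0) : e₁ • a ∈ baerLine σ 0 e₁ \ baerLine σ 0 e₂ := by
  refine ⟨(mem_baerLine_zero he₁).2 ⟨a, ha, rfl⟩, ?_⟩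
  rw [bar_eq_self_iff] at ha
  simp only [mem_baerLine, Prod.fst_zero, Prod.snd_zero, sub_zero, map_zero, Prod.smul_fst,
    Prod.smul_snd, smul_eq_mul, map_mul, ha.1, ha.2]
  rintro ⟨h1, h2⟩
  rcases coord_ne_of_ne_zero ha0 with h0 | h0
  · exact h (mul_right_cancel₀ h0 (by linear_combination -h1))
  · exact h (mul_right_cancel₀ h0 (by linear_combination -h2))

/-- The same three real vectors are used on both lines. By symmetry in e₁, e₂, the two cross joins
for x and y meet in s(x + y), where s = e₁e₂/(e₁ + e₂), and these points all lie on sF². -/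
theorem exists_pappus_of_wedge_ne_zero {e₁ e₂ : K} (he₁ : e₁ ≠ 0) (he₂ : e₂ ≠ 0)
    (h : e₁ * σ e₂ ≠ σ e₁ * e₂) {a b c : K × K} (ha : bar σ a = a) (hb : bar σ b = b)
    (hc : bar σ c = c) (hab : wedge a b ≠ 0) (hac : wedge a c ≠ 0) (hbc : wedge b c ≠ 0) :
    IsPappusConfiguration (lines σ) (baerLine σ 0 e₁) (baerLine σ 0 e₂) (e₁ • a) (e₁ • b) (e₁ • c)
      (e₂ • a) (e₂ • b) (e₂ • c) := by
  have h' : e₂ * σ e₁ ≠ σ e₂ * e₁ := fun h0 => h (by linear_combination -h0)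
  -- Otherwise e₂ = -e₁ would span the same Baer line.
  have hs : e₁ + e₂ ≠ 0 := by
    intro h0
    have : e₂ = -e₁ := by linear_combination h0
    apply h
    rw [this, map_neg]
    ring
  have ne0 : ∀ {x y : K × K}, wedge x y ≠ 0 → x ≠ 0 ∧ y ≠ 0 ∧ x ≠ y := by
    intro x y hxy
    refine ⟨?_, ?_, ?_⟩ <;> rintro rfl <;> apply hxy <;> simp [wedge, mul_comm]
  have inj : ∀ {e : K}, e ≠ 0 → ∀ {x y : K × K}, wedge x y ≠ 0 → e • x ≠ e • y :=
    fun he x y hxy h0 => (ne0 hxy).2.2 (smul_right_injective _ he h0)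
  have thr : ∀ {f g : K}, f * σ g ≠ σ f * g → ∀ {x y : K × K}, bar σ x = x → bar σ y = y →
      wedge x y ≠ 0 → IsLineThrough (lines σ) (f • x) (g • y) (desLine (f • x) (g • y - f • x)) := by
    intro f g hfg x y hx hy hxy
    apply isLineThrough_desLine
    rw [bar_eq_self_iff] at hx hy
    simp only [wedge, bar, Prod.fst_sub, Prod.snd_sub, Prod.smul_fst, Prod.smul_snd, smul_eq_mul,
      map_sub, map_mul, hx.1, hx.2, hy.1, hy.2] at hxy ⊢
    intro h0
    exact mul_ne_zero hxy (sub_ne_zero.2 hfg) (by linear_combination -h0)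
  obtain ⟨s, hs'⟩ : ∃ s, s * (e₁ + e₂) = e₁ * e₂ := ⟨_, div_mul_cancel₀ _ hs⟩
  have hs0 : s ≠ 0 := by
    rintro rfl
    exact mul_ne_zero he₁ he₂ (by linear_combination -hs')
  have mem : ∀ {x y : K × K} (f g : K), s * (f + g) = f * g → s • (x + y) ∈
      desLine (f • x) (g • y - f • x) := by
    intro x y f g hfg
    simp only [mem_desLine, Prod.fst_sub, Prod.snd_sub, Prod.smul_fst, Prod.smul_snd, smul_eq_mul,
      Prod.fst_add, Prod.snd_add]
    linear_combination (x.1 * y.2 - x.2 * y.1) * hfg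
  have mem' : ∀ {x y : K × K}, s • (x + y) ∈ desLine (e₂ • x) (e₁ • y - e₂ • x) :=
    fun {x y} => mem e₂ e₁ (by linear_combination hs')
  have real : ∀ {x y : K × K}, bar σ x = x → bar σ y = y → s • (x + y) ∈ baerLine σ 0 s := by
    intro x y hx hy
    refine (mem_baerLine_zero hs0).2 ⟨x + y, ?_, rfl⟩
    rw [bar_eq_self_iff] at *
    simp [hx.1, hx.2, hy.1, hy.2]
  obtain ⟨a0, b0, -⟩ := ne0 hab
  have c0 := (ne0 hac).2.1
  exact IsPappusConfiguration.of_collinear uniqueJoin (baerLine_mem he₁) (baerLine_mem he₂)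
    (smul_mem_diff he₁ h ha a0) (smul_mem_diff he₁ h hb b0) (smul_mem_diff he₁ h hc c0)
    (smul_mem_diff he₂ h' ha a0) (smul_mem_diff he₂ h' hb b0) (smul_mem_diff he₂ h' hc c0)
    (inj he₁ hab) (inj he₁ hac) (inj he₁ hbc) (inj he₂ hab) (inj he₂ hac) (inj he₂ hbc)
    (thr h hb hc hbc) (thr h' hb hc hbc) (thr h ha hc hac) (thr h' ha hc hac) (thr h ha hb hab)
    (thr h' ha hb hab) (A₃ := s • (b + c)) (B₃ := s • (a + c)) (C₃ := s • (a + b))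
    ⟨mem _ _ hs', mem'⟩ ⟨mem _ _ hs', mem'⟩ ⟨mem _ _ hs', mem'⟩ (baerLine_mem hs0) (real hb hc)
    (real ha hc) (real ha hb)

/-- When two of the real vectors are a and βa, all joins can be made parallel: two pairs have Baer
directions e₂ - e₁ and βe₂ - e₁, and in the third pair one difference is β times the other. -/
theorem exists_pappus_of_smul {e₁ e₂ : K} (he₁ : e₁ ≠ 0) (he₂ : e₂ ≠ 0)
    (h : e₁ * σ e₂ ≠ σ e₁ * e₂) {a c : K × K} {β : K} (ha : bar σ a = a) (hβ : σ β = β)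
    (hc : bar σ c = c) (hβ0 : β ≠ 0) (ha0 : a ≠ 0) (hc0 : c ≠ 0) (hab : a ≠ β • a) (hac : a ≠ c)
    (hbc : β • a ≠ c) :
    IsPappusConfiguration (lines σ) (baerLine σ 0 e₁) (baerLine σ 0 e₂) (e₁ • a) (e₁ • β • a)
      (e₁ • c) (e₂ • β • c) (e₂ • c) (e₂ • β • a) := by
  have h' : e₂ * σ e₁ ≠ σ e₂ * e₁ := fun h0 => h (by linear_combination -h0)
  have inj : ∀ {e : K}, e ≠ 0 → ∀ {x y : K × K}, x ≠ y → e • x ≠ e • y :=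
    fun he x y hxy h0 => hxy (smul_right_injective _ he h0)
  have real : ∀ {x : K × K}, bar σ x = x → bar σ (β • x) = β • x := by
    intro x hx
    rw [bar_eq_self_iff] at *
    simp [hβ, hx.1, hx.2]
  have ha' := ha
  have hc' := hc
  rw [bar_eq_self_iff] at ha' hc'
  have hβ1 : β ≠ 1 := by
    rintro rfl
    exact hab (one_smul _ _).symm
  refine IsPappusConfiguration.of_parallel uniqueJoin (baerLine_mem he₁) (baerLine_mem he₂)
    (smul_mem_diff he₁ h ha ha0) (smul_mem_diff he₁ h (real ha) (smul_ne_zero hβ0 ha0))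
    (smul_mem_diff he₁ h hc hc0) (smul_mem_diff he₂ h' (real hc) (smul_ne_zero hβ0 hc0))
    (smul_mem_diff he₂ h' hc hc0) (smul_mem_diff he₂ h' (real ha) (smul_ne_zero hβ0 ha0))
    (inj he₁ hab) (inj he₁ hac) (inj he₁ hbc) (inj he₂ ?_) (inj he₂ ?_) (inj he₂ hbc.symm) ?_ ?_ ?_
  · intro h0
    exact hβ1 (smul_left_injective K hc0 (by simpa using h0))
  · intro h0
    exact hac (smul_right_injective _ hβ0 h0).symm
  · refine parallel_of_baerLine (e := e₂ - e₁) ?_ ?_ ?_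
    · intro h0
      rw [sub_eq_zero.1 h0, mul_comm] at h
      exact h rfl
    · refine Prod.ext ?_ ?_ <;> simp only [bar, Prod.fst_sub, Prod.snd_sub, Prod.smul_fst,
        Prod.smul_snd, smul_eq_mul, map_sub, map_mul, hβ, ha'.1, ha'.2] <;> ring
    · refine Prod.ext ?_ ?_ <;> simp only [bar, Prod.fst_sub, Prod.snd_sub, Prod.smul_fst,
        Prod.smul_snd, smul_eq_mul, map_sub, map_mul, hc'.1, hc'.2] <;> ring
  · refine parallel_of_baerLine (e := β * e₂ - e₁) ?_ ?_ ?_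
    · intro h0
      rw [← sub_eq_zero.1 h0, map_mul, hβ] at h
      exact h (by ring)
    · refine Prod.ext ?_ ?_ <;> simp only [bar, Prod.fst_sub, Prod.snd_sub, Prod.smul_fst,
        Prod.smul_snd, smul_eq_mul, map_sub, map_mul, hβ, ha'.1, ha'.2] <;> ring
    · refine Prod.ext ?_ ?_ <;> simp only [bar, Prod.fst_sub, Prod.snd_sub, Prod.smul_fst,
        Prod.smul_snd, smul_eq_mul, map_sub, map_mul, hβ, hc'.1, hc'.2] <;> ring
  · refine parallel_of_smul hβ ?_ ?_
    · intro h0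
      refine (smul_mem_diff he₁ h ha ha0).2 ?_
      rw [h0]
      exact (smul_mem_diff he₂ h' hc hc0).1
    · refine Prod.ext ?_ ?_ <;> simp only [Prod.fst_sub, Prod.snd_sub, Prod.smul_fst,
        Prod.smul_snd, smul_eq_mul] <;> ring

theorem exists_smul_of_wedge_eq_zero {a b : K × K} (ha : bar σ a = a) (hb : bar σ b = b)
    (ha0 : a ≠ 0) (h : wedge a b = 0) : ∃ β, σ β = β ∧ b = β • a := by
  rw [bar_eq_self_iff] at ha hb
  simp only [wedge] at h
  rcases coord_ne_of_ne_zero ha0 with h0 | h0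
  · refine ⟨b.1 / a.1, by simp [ha.1, hb.1], Prod.ext ?_ ?_⟩
    · simp [div_mul_cancel₀ _ h0]
    · simp only [Prod.smul_snd, smul_eq_mul]
      field_simp
      linear_combination h
  · refine ⟨b.2 / a.2, by simp [ha.2, hb.2], Prod.ext ?_ ?_⟩
    · simp only [Prod.smul_fst, smul_eq_mul]
      field_simp
      linear_combination -h
    · simp [div_mul_cancel₀ _ h0]

theorem exists_pappus_baer_baer {e₁ e₂ : K} (he₁ : e₁ ≠ 0) (he₂ : e₂ ≠ 0)
    (h : e₁ * σ e₂ ≠ σ e₁ * e₂) {A B C : K × K} (hA : A ∈ baerLine σ 0 e₁ \ baerLine σ 0 e₂)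
    (hB : B ∈ baerLine σ 0 e₁ \ baerLine σ 0 e₂) (hC : C ∈ baerLine σ 0 e₁ \ baerLine σ 0 e₂)
    (hAB : A ≠ B) (hAC : A ≠ C) (hBC : B ≠ C) : ∃ A₂ B₂ C₂,
      IsPappusConfiguration (lines σ) (baerLine σ 0 e₁) (baerLine σ 0 e₂) A B C A₂ B₂ C₂ := by
  have dep : ∀ {A B C : K × K}, A ∈ baerLine σ 0 e₁ \ baerLine σ 0 e₂ →
      B ∈ baerLine σ 0 e₁ \ baerLine σ 0 e₂ → C ∈ baerLine σ 0 e₁ \ baerLine σ 0 e₂ →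
      A ≠ B → A ≠ C → B ≠ C → wedge (e₁⁻¹ • A) (e₁⁻¹ • B) = 0 → ∃ A₂ B₂ C₂,
      IsPappusConfiguration (lines σ) (baerLine σ 0 e₁) (baerLine σ 0 e₂) A B C A₂ B₂ C₂ := by
    intro A B C hA hB hC hAB hAC hBC hw
    obtain ⟨a, ha, rfl⟩ := (mem_baerLine_zero he₁).1 hA.1
    obtain ⟨b, hb, rfl⟩ := (mem_baerLine_zero he₁).1 hB.1
    obtain ⟨c, hc, rfl⟩ := (mem_baerLine_zero he₁).1 hC.1
    simp only [inv_smul_smul₀ he₁] at hw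
    have n0 : ∀ {x : K × K}, e₁ • x ∈ baerLine σ 0 e₁ \ baerLine σ 0 e₂ → x ≠ 0 := by
      rintro x hx rfl
      exact hx.2 (by simpa using base_mem_baerLine (σ := σ) 0 e₂)
    obtain ⟨β, hβ, rfl⟩ := exists_smul_of_wedge_eq_zero ha hb (n0 hA) hw
    refine ⟨_, _, _, exists_pappus_of_smul he₁ he₂ h ha hβ hc ?_ (n0 hA) (n0 hC) ?_ ?_ ?_⟩
    · rintro rfl
      exact n0 hB (zero_smul _ _)
    · intro h0; exact hAB (congrArg _ h0)
    · intro h0; exact hAC (congrArg _ h0)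
    · intro h0; exact hBC (congrArg _ h0)
  by_cases hab : wedge (e₁⁻¹ • A) (e₁⁻¹ • B) = 0
  · exact dep hA hB hC hAB hAC hBC hab
  by_cases hac : wedge (e₁⁻¹ • A) (e₁⁻¹ • C) = 0
  · obtain ⟨A₂, C₂, B₂, hp⟩ := dep hA hC hB hAC hAB hBC.symm hac
    exact ⟨A₂, B₂, C₂, hp.swap_BC⟩
  by_cases hbc : wedge (e₁⁻¹ • B) (e₁⁻¹ • C) = 0
  · obtain ⟨B₂, C₂, A₂, hp⟩ := dep hB hC hA hBC hAB.symm hAC.symm hbc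
    exact ⟨A₂, B₂, C₂, hp.swap_BC.swap_AB⟩
  obtain ⟨a, ha, rfl⟩ := (mem_baerLine_zero he₁).1 hA.1
  obtain ⟨b, hb, rfl⟩ := (mem_baerLine_zero he₁).1 hB.1
  obtain ⟨c, hc, rfl⟩ := (mem_baerLine_zero he₁).1 hC.1
  simp only [inv_smul_smul₀ he₁] at hab hac hbc
  exact ⟨_, _, _, exists_pappus_of_wedge_ne_zero he₁ he₂ h ha hb hc hab hac hbc⟩

end TwoBaerLines

end HallModel

/-! ### A K-line and a Baer line. -/

namespace HallModel

variable {K : Type*} [Field K] {σ : K →+* K}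

theorem bar_involutive (hσ : Function.Involutive σ) : Function.Involutive (bar σ) :=
  fun v => Prod.ext (hσ v.1) (hσ v.2)

theorem image_bar_desLine (hσ : Function.Involutive σ) (v d : K × K) :
    bar σ '' desLine v d = desLine (bar σ v) (bar σ d) := by
  rw [Set.image_eq_preimage_of_inverse (bar_involutive hσ) (bar_involutive hσ)]
  ext w
  rw [Set.mem_preimage, mem_desLine, mem_desLine, ← map_eq_zero σ]
  simp [bar, hσ _]

theorem image_bar_baerLine (hσ : Function.Involutive σ) (v : K × K) (e : K) :
    bar σ '' baerLine σ v e = baerLine σ (bar σ v) (σ e) := by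
  rw [Set.image_eq_preimage_of_inverse (bar_involutive hσ) (bar_involutive hσ)]
  ext w
  rw [Set.mem_preimage, mem_baerLine, mem_baerLine]
  simp only [bar, hσ _]
  exact and_congr eq_comm eq_comm

theorem wedge_bar_bar (v w : K × K) : wedge (bar σ v) (bar σ w) = σ (wedge v w) := by
  simp [wedge, bar]

theorem image_bar_mem (hσ : Function.Involutive σ) {l : Set (K × K)} (hl : l ∈ lines σ) :
    bar σ '' l ∈ lines σ := by
  rcases hl with ⟨v, d, hd, rfl⟩ | ⟨v, e, he, rfl⟩
  · rw [image_bar_desLine hσ]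
    exact desLine_mem (by rw [wedge_bar_bar]; exact (map_ne_zero σ).2 hd)
  · rw [image_bar_baerLine hσ]
    exact baerLine_mem ((map_ne_zero σ).2 he)

theorem mem_baerLine_one {v : K × K} : v ∈ baerLine σ 0 1 ↔ bar σ v = v := by
  simp [mem_baerLine, bar_eq_self_iff]

theorem wedge_smul_smul (x y : K) (v w : K × K) : wedge (x • v) (y • w) = x * y * wedge v w := by
  simp only [wedge, Prod.smul_fst, Prod.smul_snd, smul_eq_mul]; ring

theorem smul_mem_desLine (x : K) (d : K × K) : x • d ∈ desLine 0 d := by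
  simp [mem_desLine]; ring

theorem bar_smul (x : K) (v : K × K) : bar σ (x • v) = σ x • bar σ v := by
  simp [bar]

theorem smul_mem_desLine_diff_baerLine {d : K × K} (hd : wedge d (bar σ d) ≠ 0) {x : K}
    (hx : x ≠ 0) : x • d ∈ desLine 0 d \ baerLine σ 0 1 := by
  refine ⟨smul_mem_desLine x d, fun h => ?_⟩
  rw [mem_baerLine_one] at h
  have : wedge (x • d) (bar σ (x • d)) = 0 := by
    rw [h]; simp only [wedge]; ring
  rw [bar_smul, wedge_smul_smul] at this
  exact mul_ne_zero (mul_ne_zero hx ((map_ne_zero σ).2 hx)) hd this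

theorem mem_baerLine_diff_desLine {d : K × K} (hd : wedge d (bar σ d) ≠ 0) {w : K × K}
    (hw : bar σ w = w) (hw0 : w ≠ 0) : w ∈ baerLine σ 0 1 \ desLine 0 d := by
  refine ⟨mem_baerLine_one.2 hw, fun h => ?_⟩
  obtain ⟨x, rfl⟩ := (mem_desLine_zero (ne_zero_of_wedge hd)).1 h
  have hx : x ≠ 0 := by
    rintro rfl
    exact hw0 (zero_smul _ _)
  exact (smul_mem_desLine_diff_baerLine hd hx).2 (mem_baerLine_one.2 hw)

/-- Conjugation is an involution with the axis `baerLine σ 0 1`. -/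
theorem pappus_of_conjugation (hσ : Function.Involutive σ) {d : K × K}
    (hd : wedge d (bar σ d) ≠ 0) {a b c : K} (ha : a ≠ 0) (hb : b ≠ 0) (hc : c ≠ 0) (hab : a ≠ b)
    (hac : a ≠ c) (hbc : b ≠ c) (hab' : a + b ≠ 0) (hac' : a + c ≠ 0) (hbc' : b + c ≠ 0) :
    (∃ A₂ B₂ C₂, IsPappusConfiguration (lines σ) (desLine 0 d) (baerLine σ 0 1)
      (a • d) (b • d) (c • d) A₂ B₂ C₂) ∧
    IsPappusConfiguration (lines σ) (desLine 0 d) (desLine 0 (bar σ d)) (a • d) (b • d) (c • d)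
      (bar σ (a • d)) (bar σ (b • d)) (bar σ (c • d)) := by
  have d0 : d ≠ 0 := by
    rintro rfl
    exact hd (by simp [wedge])
  have e0 : bar σ '' desLine 0 d = desLine 0 (bar σ d) := by
    rw [image_bar_desLine hσ, show bar σ (0 : K × K) = 0 by simp [bar, Prod.ext_iff]]
  have off : ∀ {x : K}, x ≠ 0 → x • d ∉ bar σ '' desLine 0 d := by
    intro x hx h
    rw [e0] at h
    refine mul_ne_zero hx hd ?_
    simp only [mem_desLine, Prod.fst_zero, Prod.snd_zero, sub_zero, Prod.smul_fst, Prod.smul_snd,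
      smul_eq_mul] at h
    simp only [wedge]
    linear_combination h
  have join : ∀ {x y : K}, x ≠ 0 → x + y ≠ 0 → ∃ g ∈ lines σ, x • d ∈ g ∧ bar σ (y • d) ∈ g ∧
      ∃ X ∈ g, X ∈ baerLine σ 0 1 := by
    intro x y hx hxy
    have hne : x • d ≠ bar σ (y • d) := fun h => off hx (h ▸ ⟨_, smul_mem_desLine y d, rfl⟩)
    obtain ⟨g, hg, h1, h2⟩ := exists_line_through (σ := σ) hne
    refine ⟨g, hg, h1, h2, exists_meet hσ hg (baerLine_mem one_ne_zero) (base_mem_baerLine _ _) h1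
      h2 fun h => ?_⟩
    -- The join has a direction of the axis only if the vector from x d to the conjugate of y d is
    -- real, that is, only if (x + y) d is real.
    refine (smul_mem_desLine_diff_baerLine hd hxy).2 (mem_baerLine_one.2 ?_)
    rw [mem_baerLine_one, bar_eq_self_iff] at h
    rw [bar_eq_self_iff]
    simp only [bar, Prod.fst_sub, Prod.snd_sub, Prod.smul_fst, Prod.smul_snd, smul_eq_mul, map_sub,
      map_mul, map_add, hσ _] at h ⊢
    exact ⟨by linear_combination -h.1, by linear_combination -h.2⟩
  have inj : ∀ {x y : K}, x ≠ y → x • d ≠ y • d := fun h h' => h (smul_left_injective K d0 h')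
  have := IsPappusConfiguration.of_involution uniqueJoin (bar_involutive hσ)
    (fun l hl => image_bar_mem hσ hl) (desLine_mem hd) (baerLine_mem one_ne_zero)
    (fun P hP => mem_baerLine_one.1 hP) (smul_mem_desLine_diff_baerLine hd ha)
    (smul_mem_desLine_diff_baerLine hd hb) (smul_mem_desLine_diff_baerLine hd hc) (off ha) (off hb)
    (off hc) (inj hab) (inj hac) (inj hbc) (join ha hab') (join ha hac') (join hb hbc')
  rwa [e0] at this

section OppositePoints

/-- Inverse coordinates a⁻¹, 1, -1 along a real vector w make the difference vectors in each pair
proportional, with the factors -1, -a⁻¹ and a⁻¹ in F. -/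
theorem pappus_opposite_of_real {d : K × K} (hd : wedge d (bar σ d) ≠ 0)
    (h2 : (2 : K) ≠ 0) {a : K} (ha : σ a = a) (ha0 : a ≠ 0) (ha1 : a ≠ 1) (ha2 : a ≠ -1) :
    ∃ A₂ B₂ C₂, IsPappusConfiguration (lines σ) (desLine 0 d) (baerLine σ 0 1)
      (a • d) ((1 : K) • d) ((-1 : K) • d) A₂ B₂ C₂ := by
  obtain ⟨w, hw, hw0⟩ : ∃ w : K × K, bar σ w = w ∧ w ≠ 0 := ⟨(1, 0), by simp [bar], by simp⟩
  have d0 : d ≠ 0 := by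
    rintro rfl
    exact hd (by simp [wedge])
  have n1 : (1 : K) ≠ -1 := fun h => h2 (by linear_combination h)
  have i1 : a⁻¹ ≠ 1 := fun h => ha1 (by rw [← inv_inv a, h, inv_one])
  have i2 : a⁻¹ ≠ -1 := fun h => ha2 (by rw [← inv_inv a, h, inv_neg, inv_one])
  have inj : ∀ {v : K × K}, v ≠ 0 → ∀ {x y : K}, x ≠ y → x • v ≠ y • v :=
    fun hv x y h h' => h (smul_left_injective K hv h')
  have rl : ∀ {x : K}, σ x = x → x ≠ 0 → x • w ∈ baerLine σ 0 1 \ desLine 0 d := by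
    intro x hx hx0
    exact mem_baerLine_diff_desLine hd (by rw [bar_smul, hx, hw]) (smul_ne_zero hx0 hw0)
  have ne : ∀ {x y : K}, x ≠ 0 → σ y = y → y ≠ 0 → x • d ≠ y • w := by
    intro x y hx hy hy0 h
    exact (rl hy hy0).2 (h ▸ smul_mem_desLine x d)
  have si : σ a⁻¹ = a⁻¹ := by rw [map_inv₀, ha]
  have i0 : a⁻¹ ≠ 0 := inv_ne_zero ha0
  have m0 : (-1 : K) ≠ 0 := neg_ne_zero.2 one_ne_zero
  have sm : σ (-1) = -1 := by simp
  refine ⟨a⁻¹ • w, (1 : K) • w, (-1 : K) • w, IsPappusConfiguration.of_parallel uniqueJoin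
    (desLine_mem hd) (baerLine_mem one_ne_zero) (smul_mem_desLine_diff_baerLine hd ha0)
    (smul_mem_desLine_diff_baerLine hd one_ne_zero) (smul_mem_desLine_diff_baerLine hd m0)
    (rl si i0) (rl (map_one σ) one_ne_zero) (rl sm m0) (inj d0 ha1) (inj d0 ha2) (inj d0 n1)
    (inj hw0 i1) (inj hw0 i2) (inj hw0 n1)
    (parallel_of_smul (k := -1) sm (ne one_ne_zero sm m0) ?_)
    (parallel_of_smul (k := -a⁻¹) (by rw [map_neg, si]) (ne ha0 sm m0) ?_)
    (parallel_of_smul si (ne ha0 (map_one σ) one_ne_zero) ?_)⟩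
  · module
  · simp only [smul_sub, smul_smul, neg_mul, inv_mul_cancel₀ ha0]
    module
  · rw [smul_sub, smul_smul, smul_smul, inv_mul_cancel₀ ha0]
    module

/-- Let T(x) be x d plus its conjugate; the second triple is T(1), T(a), T(-a). One pair has
differences of ratio -1, and one pair has the direction of the conjugate of d. In the remaining
pair, -2 = 1 makes both differences change sign under conjugation, so they lie in (a - σ a)F². -/
theorem pappus_opposite_of_three_eq_zero {d : K × K} (hd : wedge d (bar σ d) ≠ 0)
    (hσ : Function.Involutive σ) (h3 : (3 : K) = 0) {a : K} (ha : σ a ≠ a) :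
    ∃ A₂ B₂ C₂, IsPappusConfiguration (lines σ) (desLine 0 d) (baerLine σ 0 1)
      (a • d) ((1 : K) • d) ((-1 : K) • d) A₂ B₂ C₂ := by
  have h2 : (2 : K) ≠ 0 := by
    intro h
    exact one_ne_zero (α := K) (by linear_combination h3 - h)
  have n1 : (1 : K) ≠ -1 := fun h => h2 (by linear_combination h)
  have d0 : d ≠ 0 := by
    rintro rfl
    exact hd (by simp [wedge])
  have ha0 : a ≠ 0 := by rintro rfl; simp at ha
  have ha1 : a ≠ 1 := by rintro rfl; simp at ha
  have ha2 : a ≠ -1 := by rintro rfl; simp at ha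
  have m0 : (-1 : K) ≠ 0 := neg_ne_zero.2 one_ne_zero
  have inj : ∀ {x y : K}, x ≠ y → x • d ≠ y • d := fun h h' => h (smul_left_injective K d0 h')
  have inj' : ∀ {x y : K}, x ≠ y → x • d + σ x • bar σ d ≠ y • d + σ y • bar σ d := by
    intro x y hxy h
    apply hxy
    apply mul_right_cancel₀ hd
    have h1 := congrArg Prod.fst h
    have h2 := congrArg Prod.snd h
    simp only [Prod.fst_add, Prod.snd_add, Prod.smul_fst, Prod.smul_snd, smul_eq_mul] at h1 h2
    simp only [wedge]
    linear_combination (bar σ d).2 * h1 - (bar σ d).1 * h2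
  have rl : ∀ {x : K}, x ≠ 0 → x • d + σ x • bar σ d ∈ baerLine σ 0 1 \ desLine 0 d := by
    intro x hx
    refine mem_baerLine_diff_desLine hd ?_ ?_
    · simp [bar, hσ _, Prod.ext_iff, add_comm]
    · have := inj' hx
      simpa using this
  refine ⟨(1 : K) • d + σ 1 • bar σ d, a • d + σ a • bar σ d, (-a) • d + σ (-a) • bar σ d,
    IsPappusConfiguration.of_parallel uniqueJoin (desLine_mem hd) (baerLine_mem one_ne_zero)
    (smul_mem_desLine_diff_baerLine hd ha0) (smul_mem_desLine_diff_baerLine hd one_ne_zero)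
    (smul_mem_desLine_diff_baerLine hd m0) (rl one_ne_zero) (rl ha0) (rl (neg_ne_zero.2 ha0))
    (inj ha1) (inj ha2) (inj n1) (inj' ha1.symm) (inj' ?_) (inj' ?_)
    (parallel_of_smul (k := -1) (by simp) ?_ ?_)
    (parallel_of_baerLine (e := a - σ a) (sub_ne_zero.2 ha.symm) ?_ ?_)
    (parallel_of_desLine (d := bar σ d) ?_ ?_ ?_)⟩
  · intro h
    exact ha2 (by linear_combination h)
  · intro h
    exact mul_ne_zero h2 ha0 (by linear_combination h)
  · intro h
    exact (rl (neg_ne_zero.2 ha0)).2 (h ▸ smul_mem_desLine 1 d)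
  · simp only [map_neg]
    module
  · refine Prod.ext ?_ ?_
    · simp only [bar, Prod.fst_sub, Prod.smul_fst, smul_eq_mul, map_sub, map_mul, map_neg, map_add,
        hσ _, Prod.fst_add]
      linear_combination -(a - σ a) * (a * d.1 + σ a * σ d.1) * h3
    · simp only [bar, Prod.snd_sub, Prod.smul_snd, smul_eq_mul, map_sub, map_mul, map_neg, map_add,
        hσ _, Prod.snd_add]
      linear_combination -(a - σ a) * (a * d.2 + σ a * σ d.2) * h3
  · refine Prod.ext ?_ ?_
    · simp only [bar, Prod.fst_sub, Prod.smul_fst, smul_eq_mul, map_sub, map_mul, map_neg, map_add,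
        hσ _, Prod.fst_add, map_one]
      linear_combination (a - σ a) * (d.1 + σ d.1) * h3
    · simp only [bar, Prod.snd_sub, Prod.smul_snd, smul_eq_mul, map_sub, map_mul, map_neg, map_add,
        hσ _, Prod.snd_add, map_one]
      linear_combination (a - σ a) * (d.2 + σ d.2) * h3
  · rw [wedge_bar_bar]
    exact (map_ne_zero σ).2 hd
  · simp [wedge]; ring
  · simp [wedge]; ring

theorem wedge_combination (d G : K × K) (X Y X' Y' : K) :
    wedge (X • d + Y • G) (X' • d + Y' • G) = (X * Y' - X' * Y) * wedge d G := by
  simp only [wedge, Prod.fst_add, Prod.snd_add, Prod.smul_fst, Prod.smul_snd, smul_eq_mul]; ring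

/-- In coordinates X d + Y G with G real, the points -G, G, G/2 complete a Pappus configuration of
the affine plane over K. The freedom in scaling G is used to keep the six joins and the Pappus line
in non-real directions. -/
theorem pappus_opposite_of_not_real {d : K × K} (hd : wedge d (bar σ d) ≠ 0)
    (hσ : Function.Involutive σ) (h2 : (2 : K) ≠ 0) (h3 : (3 : K) ≠ 0) {a : K} (ha : σ a ≠ a) :
    ∃ A₂ B₂ C₂, IsPappusConfiguration (lines σ) (desLine 0 d) (baerLine σ 0 1)
      (a • d) ((1 : K) • d) ((-1 : K) • d) A₂ B₂ C₂ := by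
  have ha0 : a ≠ 0 := by rintro rfl; simp at ha
  have ha1 : a ≠ 1 := by rintro rfl; simp at ha
  have ha2 : a ≠ -1 := by rintro rfl; simp at ha
  have ha3 : 1 - 2 * a ≠ 0 := by
    intro h
    have : σ (2 * a) = 2 * a := by rw [← sub_eq_zero.1 h, map_one]
    rw [map_mul, map_ofNat] at this
    exact ha (mul_left_cancel₀ h2 this)
  have ha4 : 1 + a ≠ 0 := fun h => ha2 (by linear_combination h)
  have hN : a * σ a ≠ 0 := mul_ne_zero ha0 ((map_ne_zero σ).2 ha0)
  have hη : a - σ a ≠ 0 := sub_ne_zero.2 ha.symm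
  -- The conditions on 1 + s and 2 + s concern the joins of `a • d` with G and with G/2, the last
  -- condition the Pappus line. That last expression cannot vanish for both s = 1 and s = 2, as the
  -- values differ by 36 a σ(a).
  obtain ⟨s, hs, hs0, hs1, hs2, hs3⟩ : ∃ s : K, σ s = s ∧ s ≠ 0 ∧ 1 + s ≠ 0 ∧ 2 + s ≠ 0 ∧
      (7 * a + 1) * (7 * σ a + 1) + 36 * s * (a * σ a) ≠ 0 := by
    by_cases h : (7 * a + 1) * (7 * σ a + 1) + 36 * 1 * (a * σ a) = 0
    · refine ⟨2, map_ofNat σ 2, h2, ?_, ?_, fun h' => ?_⟩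
      · intro h; exact h3 (by linear_combination h)
      · intro h; exact mul_ne_zero h2 h2 (by linear_combination h)
      · exact mul_ne_zero (mul_ne_zero (mul_ne_zero h2 h3) (mul_ne_zero h2 h3)) hN
          (by linear_combination h' - h)
    · refine ⟨1, map_one σ, one_ne_zero, ?_, ?_, h⟩
      · intro h; exact h2 (by linear_combination h)
      · intro h; exact h3 (by linear_combination h)
  -- This δ changes sign under σ, which makes G real, and it turns the determinant of the direction
  -- (-a, 1) into a multiple of (1 + s) a σ(a).
  obtain ⟨δ, hδ⟩ : ∃ δ, δ * (a - σ a) = s * (a * σ a) := ⟨_, div_mul_cancel₀ _ hη⟩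
  have hδ0 : δ ≠ 0 := by
    rintro rfl
    exact mul_ne_zero hs0 hN (by linear_combination -hδ)
  have hδ' : σ δ = -δ := by
    have h := congrArg σ hδ
    simp only [map_mul, map_sub, hσ _, hs] at h
    apply mul_right_cancel₀ hη
    linear_combination -h + hδ
  obtain ⟨G, hG⟩ : ∃ G, G = δ • (d - bar σ d) := ⟨_, rfl⟩
  have hGr : bar σ G = G := by
    rw [hG, bar_eq_self_iff]
    simp only [bar, Prod.fst_sub, Prod.snd_sub, Prod.smul_fst, Prod.smul_snd, smul_eq_mul, map_mul,
      map_sub, hσ _, hδ']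
    exact ⟨by ring, by ring⟩
  have hdG : wedge d G = -δ * wedge d (bar σ d) := by
    simp only [hG, wedge, Prod.fst_sub, Prod.snd_sub, Prod.smul_fst, Prod.smul_snd, smul_eq_mul]
    ring
  have hG0 : G ≠ 0 := by
    intro h
    rw [h] at hdG
    exact mul_ne_zero (neg_ne_zero.2 hδ0) hd (by rw [← hdG]; simp [wedge])
  have d0 : d ≠ 0 := by
    rintro rfl
    exact hd (by simp [wedge])
  have nbf : ∀ X Y : K, X * σ X - δ * (X * σ Y - σ X * Y) ≠ 0 →
      wedge (X • d + Y • G) (bar σ (X • d + Y • G)) ≠ 0 := by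
    intro X Y h
    have e : wedge (X • d + Y • G) (bar σ (X • d + Y • G)) =
        (X * σ X - δ * (X * σ Y - σ X * Y)) * wedge d (bar σ d) := by
      rw [bar_eq_self_iff] at hGr
      simp only [wedge, bar, Prod.fst_add, Prod.snd_add, Prod.smul_fst, Prod.smul_snd, smul_eq_mul,
        map_add, map_mul, hGr.1, hGr.2] at hdG ⊢
      have hdG' := congrArg σ hdG
      simp only [map_mul, map_sub, map_neg, hGr.1, hGr.2, hδ', hσ _] at hdG'
      linear_combination X * σ Y * hdG - σ X * Y * hdG'
    rw [e]
    exact mul_ne_zero h hd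
  have mem : ∀ {X Y X₀ Y₀ X₁ Y₁ : K}, (X - X₀) * Y₁ - (Y - Y₀) * X₁ = 0 →
      X • d + Y • G ∈ desLine (X₀ • d + Y₀ • G) (X₁ • d + Y₁ • G) := by
    intro X Y X₀ Y₀ X₁ Y₁ h
    have : X • d + Y • G - (X₀ • d + Y₀ • G) = (X - X₀) • d + (Y - Y₀) • G := by module
    change wedge _ _ = 0
    rw [this, wedge_combination]
    linear_combination wedge d G * h
  have thr : ∀ {P Q : K × K} {X₀ Y₀ X₁ Y₁ : K}, P = X₀ • d + Y₀ • G →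
      Q = (X₀ + X₁) • d + (Y₀ + Y₁) • G → X₁ * σ X₁ - δ * (X₁ * σ Y₁ - σ X₁ * Y₁) ≠ 0 →
      IsLineThrough (lines σ) P Q (desLine (X₀ • d + Y₀ • G) (X₁ • d + Y₁ • G)) := by
    rintro P Q X₀ Y₀ X₁ Y₁ rfl rfl h
    exact ⟨desLine_mem (nbf _ _ h), base_mem_desLine _ _, mem (by ring)⟩
  have inj : ∀ {v : K × K}, v ≠ 0 → ∀ {x y : K}, x ≠ y → x • v ≠ y • v :=
    fun hv x y h h' => h (smul_left_injective K hv h')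
  have rl : ∀ {x : K}, σ x = x → x ≠ 0 → x • G ∈ baerLine σ 0 1 \ desLine 0 d := by
    intro x hx hx0
    exact mem_baerLine_diff_desLine hd (by rw [bar_smul, hx, hGr]) (smul_ne_zero hx0 hG0)
  have n1 : (1 : K) ≠ -1 := fun h => h2 (by linear_combination h)
  have m0 : (-1 : K) ≠ 0 := neg_ne_zero.2 one_ne_zero
  have sm : σ (-1) = -1 := by simp
  have sh : σ 2⁻¹ = 2⁻¹ := by rw [map_inv₀, map_ofNat]
  have i2 : (2 : K)⁻¹ * 2 = 1 := inv_mul_cancel₀ h2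
  have i0 : (2 : K)⁻¹ ≠ 0 := inv_ne_zero h2
  have nh : (-1 : K) ≠ 2⁻¹ := by
    intro h
    rw [← h] at i2
    exact h3 (by linear_combination -i2)
  have nh' : (1 : K) ≠ 2⁻¹ := by
    intro h
    rw [← h] at i2
    exact one_ne_zero (α := K) (by linear_combination i2)
  -- Coordinates of the three diagonal points, found by intersecting the pairs of joins.
  obtain ⟨X₁, Y₁, hX₁, hY₁⟩ : ∃ X Y : K, 3 * X = -1 ∧ 3 * Y = 2 :=
    ⟨-1 / 3, 2 / 3, by field_simp, by field_simp⟩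
  obtain ⟨X₂, Y₂, hX₂, hY₂⟩ : ∃ X Y : K, (1 - 2 * a) * X = 3 * a ∧ (1 - 2 * a) * Y = -1 - a :=
    ⟨_, _, mul_div_cancel₀ _ ha3, mul_div_cancel₀ _ ha3⟩
  obtain ⟨X₃, Y₃, hX₃, hY₃⟩ : ∃ X Y : K, (1 + a) * X = 2 * a ∧ (1 + a) * Y = a - 1 :=
    ⟨_, _, mul_div_cancel₀ _ ha4, mul_div_cancel₀ _ ha4⟩
  refine ⟨(-1 : K) • G, (1 : K) • G, (2⁻¹ : K) • G, IsPappusConfiguration.of_collinear uniqueJoin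
    (desLine_mem hd) (baerLine_mem one_ne_zero) (smul_mem_desLine_diff_baerLine hd ha0)
    (smul_mem_desLine_diff_baerLine hd one_ne_zero) (smul_mem_desLine_diff_baerLine hd m0)
    (rl sm m0) (rl (map_one σ) one_ne_zero) (rl sh i0) (inj d0 ha1) (inj d0 ha2) (inj d0 n1)
    (inj hG0 n1.symm) (inj hG0 nh) (inj hG0 nh')
    (thr (X₀ := 1) (Y₀ := 0) (X₁ := -1) (Y₁ := 2⁻¹) (by module) (by module) ?_)
    (thr (X₀ := 0) (Y₀ := 1) (X₁ := -1) (Y₁ := -1) (by module) (by module) ?_)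
    (thr (X₀ := a) (Y₀ := 0) (X₁ := -a) (Y₁ := 2⁻¹) (by module) (by module) ?_)
    (thr (X₀ := 0) (Y₀ := -1) (X₁ := -1) (Y₁ := 1) (by module) (by module) ?_)
    (thr (X₀ := a) (Y₀ := 0) (X₁ := -a) (Y₁ := 1) (by module) (by module) ?_)
    (thr (X₀ := 0) (Y₀ := -1) (X₁ := 1) (Y₁ := 1) (by module) (by module) ?_)
    (A₃ := X₁ • d + Y₁ • G) (B₃ := X₂ • d + Y₂ • G) (C₃ := X₃ • d + Y₃ • G)
    ⟨mem ?_, mem ?_⟩ ⟨mem ?_, mem ?_⟩ ⟨mem ?_, mem ?_⟩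
    (l₃ := desLine (X₁ • d + Y₁ • G) ((7 * a + 1) • d + (a - 5) • G))
    (desLine_mem (nbf _ _ ?_)) (base_mem_desLine _ _) (mem ?_) (mem ?_)⟩
  · rw [sm, sh]; intro h; exact one_ne_zero (α := K) (by linear_combination h)
  · rw [sm]; intro h; exact one_ne_zero (α := K) (by linear_combination h)
  · rw [map_neg, sh]
    intro h
    exact mul_ne_zero hs2 hN (by linear_combination 2 * h - hδ - δ * (a - σ a) * i2)
  · rw [sm, map_one]; intro h; exact one_ne_zero (α := K) (by linear_combination h)
  · rw [map_neg, map_one]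
    intro h
    exact mul_ne_zero hs1 hN (by linear_combination h - hδ)
  · rw [map_one]; intro h; exact one_ne_zero (α := K) (by linear_combination h)
  · apply mul_left_cancel₀ (mul_ne_zero h2 h3)
    linear_combination hX₁ + 2 * hY₁ + 3 * (X₁ - 1) * i2
  · apply mul_left_cancel₀ h3
    linear_combination -hX₁ + hY₁
  · apply mul_left_cancel₀ (mul_ne_zero h2 ha3)
    linear_combination hX₂ + 2 * a * hY₂ + (1 - 2 * a) * (X₂ - a) * i2
  · apply mul_left_cancel₀ ha3
    linear_combination hX₂ + hY₂
  · apply mul_left_cancel₀ ha4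
    linear_combination hX₃ + a * hY₃
  · apply mul_left_cancel₀ ha4
    linear_combination hX₃ - hY₃
  · simp only [map_add, map_sub, map_mul, map_one, map_ofNat]
    intro h
    exact hs3 (by linear_combination h - 36 * hδ)
  · apply mul_left_cancel₀ (mul_ne_zero h3 ha3)
    linear_combination 3 * (a - 5) * hX₂ - (1 - 2 * a) * (a - 5) * hX₁ -
      3 * (7 * a + 1) * hY₂ + (1 - 2 * a) * (7 * a + 1) * hY₁
  · apply mul_left_cancel₀ (mul_ne_zero h3 ha4)
    linear_combination 3 * (a - 5) * hX₃ - (1 + a) * (a - 5) * hX₁ -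
      3 * (7 * a + 1) * hY₃ + (1 + a) * (7 * a + 1) * hY₁

theorem pappus_opposite {d : K × K} (hd : wedge d (bar σ d) ≠ 0) (hσ : Function.Involutive σ)
    (h2 : (2 : K) ≠ 0) {a : K} (ha0 : a ≠ 0) (ha1 : a ≠ 1) (ha2 : a ≠ -1) :
    ∃ A₂ B₂ C₂, IsPappusConfiguration (lines σ) (desLine 0 d) (baerLine σ 0 1)
      (a • d) ((1 : K) • d) ((-1 : K) • d) A₂ B₂ C₂ := by
  by_cases ha : σ a = a
  · exact pappus_opposite_of_real hd h2 ha ha0 ha1 ha2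
  by_cases h3 : (3 : K) = 0
  · exact pappus_opposite_of_three_eq_zero hd hσ h3 ha
  · exact pappus_opposite_of_not_real hd hσ h2 h3 ha

end OppositePoints

theorem two_ne_zero_of_add_eq_zero {b c : K} (hbc : b ≠ c) (h : b + c = 0) : (2 : K) ≠ 0 := by
  intro h2
  exact hbc (by linear_combination h - c * h2)

theorem exists_pappus_des_baer (hσ : Function.Involutive σ) {d : K × K}
    (hd : wedge d (bar σ d) ≠ 0) {A B C : K × K} (hA : A ∈ desLine 0 d \ baerLine σ 0 1)
    (hB : B ∈ desLine 0 d \ baerLine σ 0 1) (hC : C ∈ desLine 0 d \ baerLine σ 0 1)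
    (hAB : A ≠ B) (hAC : A ≠ C) (hBC : B ≠ C) : ∃ A₂ B₂ C₂,
      IsPappusConfiguration (lines σ) (desLine 0 d) (baerLine σ 0 1) A B C A₂ B₂ C₂ := by
  -- Replacing d by b d turns the opposite pair into 1, -1.
  have opp : ∀ {a b c : K}, a ≠ 0 → b ≠ 0 → a ≠ b → a ≠ c → b ≠ c → b + c = 0 →
      ∃ A₂ B₂ C₂, IsPappusConfiguration (lines σ) (desLine 0 d) (baerLine σ 0 1)
        (a • d) (b • d) (c • d) A₂ B₂ C₂ := by
    intro a b c ha hb hab hac hbc h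
    obtain rfl : c = -b := by linear_combination h
    have e0 : desLine 0 d = desLine 0 (b • d) := by
      refine desLine_eq (base_mem_desLine _ _) (ne_zero_of_wedge hd) ?_ ?_
      · have := ne_zero_of_wedge hd
        simpa [hb] using this
      · simp only [wedge, Prod.smul_fst, Prod.smul_snd, smul_eq_mul]; ring
    have hd' : wedge (b • d) (bar σ (b • d)) ≠ 0 := by
      rw [bar_smul, wedge_smul_smul]
      exact mul_ne_zero (mul_ne_zero hb ((map_ne_zero σ).2 hb)) hd
    have := pappus_opposite hd' hσ (two_ne_zero_of_add_eq_zero hbc h) (a := a / b)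
      (div_ne_zero ha hb) (fun h => hab ((div_eq_one_iff_eq hb).1 h))
      (fun h => hac (by rw [div_eq_iff hb] at h; rw [h]; ring))
    rw [← e0, smul_smul, smul_smul, smul_smul, div_mul_cancel₀ _ hb, one_mul, neg_one_mul] at this
    exact this
  have d0 := ne_zero_of_wedge hd
  obtain ⟨a, rfl⟩ := (mem_desLine_zero d0).1 hA.1
  obtain ⟨b, rfl⟩ := (mem_desLine_zero d0).1 hB.1
  obtain ⟨c, rfl⟩ := (mem_desLine_zero d0).1 hC.1
  have n0 : ∀ {x : K}, x • d ∈ desLine 0 d \ baerLine σ 0 1 → x ≠ 0 := by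
    rintro x hx rfl
    exact hx.2 (by simpa using base_mem_baerLine (σ := σ) 0 1)
  have inj : ∀ {x y : K}, x • d ≠ y • d → x ≠ y := fun h h' => h (h' ▸ rfl)
  by_cases hab : a + b = 0
  · obtain ⟨C₂, A₂, B₂, h⟩ := opp (n0 hC) (n0 hA) (inj hAC).symm (inj hBC).symm (inj hAB) hab
    exact ⟨A₂, B₂, C₂, h.swap_AB.swap_BC⟩
  by_cases hac : a + c = 0
  · obtain ⟨B₂, A₂, C₂, h⟩ := opp (n0 hB) (n0 hA) (inj hAB).symm (inj hBC) (inj hAC) hac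
    exact ⟨A₂, B₂, C₂, h.swap_AB⟩
  by_cases hbc : b + c = 0
  · exact opp (n0 hA) (n0 hB) (inj hAB) (inj hAC) (inj hBC) hbc
  exact (pappus_of_conjugation hσ hd (n0 hA) (n0 hB) (n0 hC) (inj hAB) (inj hAC) (inj hBC) hab hac
    hbc).1


end HallModel

/-! ### Two K-lines: reflections and a nonvanishing criterion. -/

namespace HallModel

variable {K : Type*} [Field K] {σ : K →+* K}

section Reflection

/-- The reflection that fixes `d` and negates its conjugate. -/
def reflection (σ : K →+* K) (d v : K × K) : K × K :=
  (wedge d (bar σ d))⁻¹ • (wedge v (bar σ d) • d - wedge d v • bar σ d)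

variable {d : K × K}

theorem reflection_sub (u v : K × K) :
    reflection σ d (u - v) = reflection σ d u - reflection σ d v := by
  refine Prod.ext ?_ ?_ <;> simp only [reflection, wedge, Prod.fst_sub, Prod.snd_sub,
    Prod.smul_fst, Prod.smul_snd, smul_eq_mul] <;> ring

theorem reflection_smul (x : K) (v : K × K) :
    reflection σ d (x • v) = x • reflection σ d v := by
  refine Prod.ext ?_ ?_ <;> simp only [reflection, wedge, Prod.fst_sub, Prod.snd_sub,
    Prod.smul_fst, Prod.smul_snd, smul_eq_mul] <;> ring

theorem reflection_self (hd : wedge d (bar σ d) ≠ 0) : reflection σ d d = d := by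
  have : wedge d d = 0 := by simp only [wedge]; ring
  rw [reflection, this, zero_smul, sub_zero, smul_smul, inv_mul_cancel₀ hd, one_smul]

theorem wedge_reflection (hd : wedge d (bar σ d) ≠ 0) (u v : K × K) :
    wedge (reflection σ d u) (reflection σ d v) = -wedge u v := by
  apply mul_left_cancel₀ hd
  have h : wedge (reflection σ d u) (reflection σ d v) = (wedge d (bar σ d))⁻¹ *
      (wedge d (bar σ d))⁻¹ * ((wedge u (bar σ d) * -wedge d v - wedge v (bar σ d) * -wedge d u) *
        wedge d (bar σ d)) := by
    rw [reflection, reflection, wedge_smul_smul, sub_eq_add_neg, sub_eq_add_neg, ← neg_smul,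
      ← neg_smul, wedge_combination]
  rw [h]
  field_simp
  simp only [wedge]
  ring

theorem reflection_reflection (hd : wedge d (bar σ d) ≠ 0) (v : K × K) :
    reflection σ d (reflection σ d v) = v := by
  have e1 : wedge d (reflection σ d v) = -wedge d v := by
    have := wedge_reflection hd d v
    rwa [reflection_self hd] at this
  have e2 : wedge (reflection σ d v) (bar σ d) = wedge v (bar σ d) := by
    rw [reflection, ← one_smul K (bar σ d), wedge_smul_smul]
    simp only [one_smul, wedge, Prod.fst_sub, Prod.snd_sub, Prod.smul_fst, Prod.smul_snd,
      smul_eq_mul] at hd ⊢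
    field_simp
    ring
  rw [reflection, e1, e2]
  have hd' := hd
  refine Prod.ext ?_ ?_ <;> simp only [wedge, Prod.fst_sub, Prod.snd_sub, Prod.smul_fst,
    Prod.smul_snd, smul_eq_mul] at hd' ⊢ <;> field_simp <;> ring

/-- Conjugation interchanges d and its conjugate, the eigenvectors for 1 and -1, so conjugating the
reflection changes its sign. -/
theorem bar_reflection (hσ : Function.Involutive σ) (v : K × K) :
    bar σ (reflection σ d v) = -reflection σ d (bar σ v) := by
  have e : σ (wedge d (bar σ d)) = -wedge d (bar σ d) := by
    simp [wedge, bar, hσ _]; ring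
  have hi : σ (wedge d (bar σ d))⁻¹ = -(wedge d (bar σ d))⁻¹ := by rw [map_inv₀, e, inv_neg]
  rw [reflection, reflection, bar_smul, hi]
  refine Prod.ext ?_ ?_ <;> simp only [wedge, bar, Prod.fst_sub, Prod.snd_sub, Prod.smul_fst,
    Prod.smul_snd, smul_eq_mul, Prod.fst_neg, Prod.snd_neg, map_sub, map_mul, hσ _] <;> ring

theorem reflection_neg (v : K × K) : reflection σ d (-v) = -reflection σ d v := by
  rw [← neg_one_smul K, reflection_smul, neg_one_smul]

theorem image_reflection_desLine (hd : wedge d (bar σ d) ≠ 0) (v e : K × K) :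
    reflection σ d '' desLine v e = desLine (reflection σ d v) (reflection σ d e) := by
  rw [Set.image_eq_preimage_of_inverse (reflection_reflection hd) (reflection_reflection hd)]
  ext w
  change wedge _ _ = 0 ↔ wedge _ _ = 0
  rw [← neg_eq_zero, ← wedge_reflection hd, reflection_sub, reflection_reflection hd]

/-- Real vectors are reflected to vectors negated by conjugation, which are the (x - σ x)-multiples
of real ones. Hence a Baer multiplier e becomes e (x - σ x). -/
theorem image_reflection_mem (hσ : Function.Involutive σ) (hne : ∃ x, σ x ≠ x)
    (hd : wedge d (bar σ d) ≠ 0) {l : Set (K × K)} (hl : l ∈ lines σ) :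
    reflection σ d '' l ∈ lines σ := by
  rcases hl with ⟨v, e, he, rfl⟩ | ⟨v, e, he, rfl⟩
  · rw [image_reflection_desLine hd]
    apply desLine_mem
    have : bar σ (reflection σ d e) = (-1 : K) • reflection σ d (bar σ e) := by
      rw [bar_reflection hσ, neg_one_smul]
    rw [this, ← one_smul K (reflection σ d e), wedge_smul_smul, wedge_reflection hd]
    simpa using he
  · obtain ⟨x, hx⟩ := hne
    have hε : x - σ x ≠ 0 := sub_ne_zero.2 hx.symm
    have hε' : σ (x - σ x) = -(x - σ x) := by rw [map_sub, hσ]; ring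
    have e0 : reflection σ d '' baerLine σ v e =
        baerLine σ (reflection σ d v) (e * (x - σ x)) := by
      rw [Set.image_eq_preimage_of_inverse (reflection_reflection hd) (reflection_reflection hd)]
      ext w
      obtain ⟨y, hy⟩ : ∃ y, y = w - reflection σ d v := ⟨_, rfl⟩
      have hy' : reflection σ d w - v = reflection σ d y := by
        rw [hy, reflection_sub, reflection_reflection hd]
      change e • bar σ (reflection σ d w - v) = σ e • (reflection σ d w - v) ↔
        (e * (x - σ x)) • bar σ (w - _) = σ (e * (x - σ x)) • (w - _)
      rw [← hy, hy', bar_reflection hσ, map_mul, hε', ← reflection_neg, ← reflection_smul,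
        ← reflection_smul, (Function.Involutive.injective (reflection_reflection hd)).eq_iff]
      constructor
      · intro h
        rw [mul_comm, mul_smul, mul_comm, mul_smul, ← h]
        module
      · intro h
        apply smul_right_injective _ hε
        simp only [← mul_smul, smul_neg]
        rw [mul_comm, h, mul_comm (x - σ x)]
        module
    rw [e0]
    exact baerLine_mem (mul_ne_zero he hε)

theorem wedge_self_reflection (v : K × K) : wedge v (reflection σ d v) =
    2 * ((wedge d (bar σ d))⁻¹ * (wedge v (bar σ d) * wedge v d)) := by
  simp only [reflection, wedge, Prod.fst_sub, Prod.snd_sub, Prod.smul_fst, Prod.smul_snd,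
    smul_eq_mul]
  ring

/-- The reflection has axis Ke. It moves Kd because 2 ≠ 0 and d is proportional neither to e nor to
its conjugate (`wedge_self_reflection`). -/
theorem pappus_of_reflection (hσ : Function.Involutive σ) (hne : ∃ x, σ x ≠ x)
    (h2 : (2 : K) ≠ 0) {d e : K × K} (hd : wedge d (bar σ d) ≠ 0) (he : wedge e (bar σ e) ≠ 0)
    (hde : wedge d e ≠ 0) (hde' : wedge d (bar σ e) ≠ 0) {a b c : K} (ha : a ≠ 0) (hb : b ≠ 0)
    (hc : c ≠ 0) (hab : a ≠ b) (hac : a ≠ c) (hbc : b ≠ c) (hab' : a + b ≠ 0) (hac' : a + c ≠ 0)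
    (hbc' : b + c ≠ 0) :
    ∃ A₂ B₂ C₂, IsPappusConfiguration (lines σ) (desLine 0 d) (desLine 0 e)
      (a • d) (b • d) (c • d) A₂ B₂ C₂ := by
  have d0 : d ≠ 0 := by
    rintro rfl
    exact hd (by simp [wedge])
  have r0 : reflection σ e 0 = 0 := by simpa using reflection_smul (σ := σ) (d := e) 0 0
  have e0 : reflection σ e '' desLine 0 d = desLine 0 (reflection σ e d) := by
    rw [image_reflection_desLine he, r0]
  have off : ∀ {x : K}, x ≠ 0 → x • d ∉ reflection σ e '' desLine 0 d := by
    intro x hx h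
    rw [e0] at h
    change wedge _ _ = 0 at h
    rw [sub_zero, ← one_smul K (reflection σ e d), wedge_smul_smul, wedge_self_reflection] at h
    exact mul_ne_zero (mul_ne_zero hx one_ne_zero) (mul_ne_zero h2 (mul_ne_zero (inv_ne_zero he)
      (mul_ne_zero hde' hde))) h
  have diff : ∀ {x : K}, x ≠ 0 → x • d ∈ desLine 0 d \ desLine 0 e := by
    intro x hx
    refine ⟨smul_mem_desLine x d, fun h => ?_⟩
    change wedge _ _ = 0 at h
    rw [sub_zero, ← one_smul K e, wedge_smul_smul] at h
    exact mul_ne_zero (mul_ne_zero hx one_ne_zero) hde h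
  have join : ∀ {x y : K}, x ≠ 0 → x + y ≠ 0 → ∃ g ∈ lines σ, x • d ∈ g ∧
      reflection σ e (y • d) ∈ g ∧ ∃ X ∈ g, X ∈ desLine 0 e := by
    intro x y hx hxy
    have hne : x • d ≠ reflection σ e (y • d) := fun h =>
      off hx (h ▸ ⟨_, smul_mem_desLine y d, rfl⟩)
    obtain ⟨g, hg, h1, h2⟩ := exists_line_through (σ := σ) hne
    refine ⟨g, hg, h1, h2, exists_meet hσ hg (desLine_mem he) (base_mem_desLine _ _) h1
      h2 fun h => ?_⟩
    change wedge _ _ = 0 at h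
    -- Consequently the joining vector has determinant -(x + y) (d ∧ e) with e, and the join meets
    -- the axis when x + y ≠ 0.
    have hr : wedge (reflection σ e d) e = -wedge d e := by
      have := wedge_reflection he d e
      rwa [reflection_self he] at this
    rw [sub_zero, reflection_smul] at h
    refine mul_ne_zero hxy hde ?_
    simp only [wedge, Prod.fst_sub, Prod.snd_sub, Prod.smul_fst, Prod.smul_snd, smul_eq_mul] at h hr ⊢
    linear_combination y * hr - h
  have inj : ∀ {x y : K}, x ≠ y → x • d ≠ y • d := fun h h' => h (smul_left_injective K d0 h')
  refine (IsPappusConfiguration.of_involution uniqueJoin (reflection_reflection he)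
    (fun l hl => image_reflection_mem hσ hne he hl) (desLine_mem hd) (desLine_mem he)
    (fun P hP => ?_) (diff ha) (diff hb) (diff hc) (off ha) (off hb)
    (off hc) (inj hab) (inj hac) (inj hbc) (join ha hab') (join ha hac') (join hb hbc')).1
  obtain ⟨x, rfl⟩ := (mem_desLine_zero (ne_zero_of_wedge he)).1 hP
  rw [reflection_smul, reflection_self he]

end Reflection

section Nonvanishing

open Polynomial

/-- A polynomial of degree at most `|K| - 1` that vanishes on `K \ {0}` is a multiple of
`X ^ (|K| - 1) - 1`. -/
theorem exists_eval_ne_zero [Fintype K] {R : K[X]} (hR : R.natDegree ≤ Fintype.card K - 1) {i : ℕ}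
    (hi : 0 < i) (hi' : i < Fintype.card K - 1) (hc : R.coeff i ≠ 0) :
    ∃ z : K, z ≠ 0 ∧ R.eval z ≠ 0 := by
  classical
  by_contra! h
  obtain ⟨n, hn⟩ : ∃ n, n = Fintype.card K - 1 := ⟨_, rfl⟩
  rw [← hn] at hR hi'
  have hn0 : n ≠ 0 := by omega
  -- The subtraction lowers the degree below n, keeps all n nonzero elements as roots and leaves the
  -- inner coefficient i unchanged.
  obtain ⟨S, hS⟩ : ∃ S : K[X], S = R - C (R.coeff n) * (X ^ n - 1) := ⟨_, rfl⟩
  have hSi : S.coeff i = R.coeff i := by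
    rw [hS, coeff_sub, coeff_C_mul, coeff_sub, coeff_X_pow, coeff_one, if_neg (by omega),
      if_neg (by omega)]
    simp
  have hS0 : S ≠ 0 := by
    intro h0
    rw [h0, coeff_zero] at hSi
    exact hc hSi.symm
  have hdeg : S.natDegree < n := by
    have h1 : S.natDegree ≤ n := by
      rw [hS]
      refine (natDegree_sub_le _ _).trans (max_le hR ((natDegree_C_mul_le _ _).trans ?_))
      rw [← C_1, natDegree_X_pow_sub_C]
    refine lt_of_le_of_ne h1 fun h2 => ?_
    have : S.coeff n = 0 := by
      rw [hS, coeff_sub, coeff_C_mul, coeff_sub, coeff_X_pow, coeff_one, if_pos rfl, if_neg hn0]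
      ring
    rw [← h2] at this
    exact hS0 (leadingCoeff_eq_zero.1 this)
  have hroots : ((Finset.univ : Finset K).erase 0).card ≤ S.natDegree := by
    by_contra! h'
    refine hS0 (eq_zero_of_natDegree_lt_card_of_eval_eq_zero' S _ (fun z hz => ?_) h')
    have hz : z ≠ 0 := Finset.ne_of_mem_erase hz
    rw [hS, eval_sub, h z hz, eval_mul, eval_sub, eval_pow, eval_X, hn,
      FiniteField.pow_card_sub_one_eq_one z hz]
    simp
  rw [Finset.card_erase_of_mem (Finset.mem_univ _), Finset.card_univ, ← hn] at hroots
  omega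

end Nonvanishing

end HallModel

/-! ### Two K-lines: parallel configurations with a free parameter. -/

namespace HallModel

variable {K : Type*} [Field K] {σ : K →+* K}

/-- With inverse coordinates on Ke, the two joins for x and y are both K-multiples of e - xyz d,
with ratio y/x. They are parallel in the derived plane if this direction is non-real or the ratio
lies in F. -/
theorem pappus_of_nonvanishing {d e : K × K} (hd : wedge d (bar σ d) ≠ 0)
    (he : wedge e (bar σ e) ≠ 0) (hde : wedge d e ≠ 0) {a b c z : K} (ha : a ≠ 0) (hb : b ≠ 0)
    (hc : c ≠ 0) (hz : z ≠ 0) (hab : a ≠ b) (hac : a ≠ c) (hbc : b ≠ c)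
    (pA : wedge (e - (b * c * z) • d) (bar σ (e - (b * c * z) • d)) ≠ 0 ∨ σ (c / b) = c / b)
    (pB : wedge (e - (a * c * z) • d) (bar σ (e - (a * c * z) • d)) ≠ 0 ∨ σ (c / a) = c / a)
    (pC : wedge (e - (a * b * z) • d) (bar σ (e - (a * b * z) • d)) ≠ 0 ∨ σ (b / a) = b / a) :
    IsPappusConfiguration (lines σ) (desLine 0 d) (desLine 0 e) (a • d) (b • d) (c • d)
      ((a * z)⁻¹ • e) ((b * z)⁻¹ • e) ((c * z)⁻¹ • e) := by
  have d0 : d ≠ 0 := by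
    rintro rfl
    exact hd (by simp [wedge])
  have e0 : e ≠ 0 := by
    rintro rfl
    exact he (by simp [wedge])
  have diff : ∀ {d e : K × K}, wedge d e ≠ 0 → ∀ {x : K}, x ≠ 0 →
      x • d ∈ desLine 0 d \ desLine 0 e := by
    intro d e hde x hx
    refine ⟨smul_mem_desLine x d, fun h => ?_⟩
    change wedge _ _ = 0 at h
    rw [sub_zero, ← one_smul K e, wedge_smul_smul] at h
    exact mul_ne_zero (mul_ne_zero hx one_ne_zero) hde h
  have hed : wedge e d ≠ 0 := by
    intro h
    apply hde
    simp only [wedge] at h ⊢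
    linear_combination -h
  have n0 : ∀ {x : K}, x ≠ 0 → (x * z)⁻¹ ≠ 0 := fun hx => inv_ne_zero (mul_ne_zero hx hz)
  have inj : ∀ {v : K × K}, v ≠ 0 → ∀ {x y : K}, x ≠ y → x • v ≠ y • v :=
    fun hv x y h h' => h (smul_left_injective K hv h')
  have inj' : ∀ {x y : K}, x ≠ y → (x * z)⁻¹ • e ≠ (y * z)⁻¹ • e :=
    fun h => inj e0 fun h' => h (mul_right_cancel₀ hz (inv_injective h'))
  have par : ∀ {x y : K}, x ≠ 0 → y ≠ 0 →
      (wedge (e - (x * y * z) • d) (bar σ (e - (x * y * z) • d)) ≠ 0 ∨ σ (y / x) = y / x) →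
      Parallel (lines σ) (x • d) ((y * z)⁻¹ • e) (y • d) ((x * z)⁻¹ • e) := by
    intro x y hx hy h
    have h1 : (x * z)⁻¹ • e - y • d = (y / x) • ((y * z)⁻¹ • e - x • d) := by
      rw [smul_sub, smul_smul, smul_smul, div_mul_cancel₀ _ hx]
      congr 2
      field_simp
    have h2 : (y * z)⁻¹ • e - x • d = (y * z)⁻¹ • (e - (x * y * z) • d) := by
      rw [smul_sub, smul_smul]
      congr 2
      field_simp
    have h3 : ∀ t : K, wedge (t • (e - (x * y * z) • d)) (e - (x * y * z) • d) = 0 := by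
      intro t
      simp only [wedge, Prod.smul_fst, Prod.smul_snd, smul_eq_mul]; ring
    rcases h with h | h
    · refine parallel_of_desLine h ?_ ?_
      · rw [h2]; exact h3 _
      · rw [h1, h2, smul_smul]; exact h3 _
    · refine parallel_of_smul h (fun h0 => ?_) h1
      exact (diff hed (n0 hy)).2 (h0 ▸ smul_mem_desLine x d)
  exact IsPappusConfiguration.of_parallel uniqueJoin (desLine_mem hd) (desLine_mem he)
    (diff hde ha) (diff hde hb) (diff hde hc) (diff hed (n0 ha)) (diff hed (n0 hb))
    (diff hed (n0 hc)) (inj d0 hab) (inj d0 hac) (inj d0 hbc) (inj' hab) (inj' hac) (inj' hbc)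
    (par hb hc pA) (par ha hc pB) (par ha hb pC)

section Nonvanishing

open Polynomial

variable {q : ℕ}

/-- The polynomial in `z` whose value is the determinant of `e - (r z) d` and its conjugate. -/
noncomputable def directionPoly (σ : K →+* K) (q : ℕ) (d e : K × K) (r : K) : K[X] :=
  C (wedge e (bar σ e)) - C (r * wedge d (bar σ e)) * X - C (σ r * wedge e (bar σ d)) * X ^ q +
    C (r * σ r * wedge d (bar σ d)) * X ^ (q + 1)

theorem eval_directionPoly (hq : ∀ x, σ x = x ^ q) (d e : K × K) (r z : K) :
    (directionPoly σ q d e r).eval z = wedge (e - (r * z) • d) (bar σ (e - (r * z) • d)) := by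
  simp only [directionPoly, eval_add, eval_sub, eval_mul, eval_C, eval_X, eval_pow, pow_succ,
    ← hq z]
  simp only [wedge, bar, Prod.fst_sub, Prod.snd_sub, Prod.smul_fst, Prod.smul_snd, smul_eq_mul,
    map_sub, map_mul]
  ring

theorem natDegree_directionPoly_le (hq : 1 ≤ q) (d e : K × K) (r : K) :
    (directionPoly σ q d e r).natDegree ≤ q + 1 := by
  refine natDegree_add_le_of_degree_le ((natDegree_sub_le _ _).trans
    (max_le ((natDegree_sub_le _ _).trans (max_le ?_ ?_)) ?_)) ?_
  · simp
  · exact (natDegree_C_mul_le _ _).trans (natDegree_X_le.trans (by omega))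
  · exact (natDegree_C_mul_X_pow_le _ _).trans (by omega)
  · exact natDegree_C_mul_X_pow_le _ _

theorem directionPoly_eq (d e : K × K) (r : K) (k j : ℕ) : ∃ B : K[X],
    directionPoly σ (k + j) d e r =
      C (wedge e (bar σ e)) + C (-(r * wedge d (bar σ e))) * X + X ^ j * B := by
  refine ⟨-C (σ r * wedge e (bar σ d)) * X ^ k +
    C (r * σ r * wedge d (bar σ d)) * X ^ (k + 1), ?_⟩
  rw [directionPoly, C_neg]
  ring

variable [Fintype K]

theorem exists_three_nonvanishing (hq : ∀ x, σ x = x ^ q) (hcard : Fintype.card K = q ^ 2)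
    (hq4 : 4 ≤ q) {d e : K × K} (hde : wedge d (bar σ e) ≠ 0) {r₁ r₂ r₃ : K} (h₁ : r₁ ≠ 0)
    (h₂ : r₂ ≠ 0) (h₃ : r₃ ≠ 0) : ∃ z ≠ 0,
      wedge (e - (r₁ * z) • d) (bar σ (e - (r₁ * z) • d)) ≠ 0 ∧
      wedge (e - (r₂ * z) • d) (bar σ (e - (r₂ * z) • d)) ≠ 0 ∧
      wedge (e - (r₃ * z) • d) (bar σ (e - (r₃ * z) • d)) ≠ 0 := by
  obtain ⟨R, hR⟩ : ∃ R, R = directionPoly σ q d e r₁ * directionPoly σ q d e r₂ *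
    directionPoly σ q d e r₃ := ⟨_, rfl⟩
  have hn : ∀ r, (directionPoly σ q d e r).natDegree ≤ q + 1 :=
    natDegree_directionPoly_le (by omega) d e
  have hdeg : R.natDegree ≤ Fintype.card K - 1 := by
    have : R.natDegree ≤ (q + 1) + (q + 1) + (q + 1) := by
      rw [hR]
      exact natDegree_mul_le.trans (add_le_add (natDegree_mul_le.trans
        (add_le_add (hn _) (hn _))) (hn _))
    -- Equality is not excluded by the degree bound, but q = 3 would fail: this is where q ≥ 4
    -- enters.
    have h2 : (q + 1) + (q + 1) + (q + 1) + 1 ≤ q ^ 2 := by nlinarith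
    omega
  have hlt : 3 < Fintype.card K - 1 := by
    have : 16 ≤ q ^ 2 := by nlinarith
    omega
  -- Since q ≥ 4, only the linear parts of the three factors contribute to this coefficient.
  have hcoeff : R.coeff 3 ≠ 0 := by
    obtain ⟨k, rfl⟩ := Nat.exists_eq_add_of_le' hq4
    obtain ⟨B₁, e₁⟩ := directionPoly_eq (σ := σ) d e r₁ k 4
    obtain ⟨B₂, e₂⟩ := directionPoly_eq (σ := σ) d e r₂ k 4
    obtain ⟨B₃, e₃⟩ := directionPoly_eq (σ := σ) d e r₃ k 4
    obtain ⟨u, hu⟩ : ∃ u, u = wedge e (bar σ e) := ⟨_, rfl⟩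
    obtain ⟨v, hv⟩ : ∃ v, v = wedge d (bar σ e) := ⟨_, rfl⟩
    rw [← hu, ← hv] at e₁ e₂ e₃
    have : R = C (u * u * u) + C (-(u * u * v * (r₁ + r₂ + r₃))) * X ^ 1 +
        C (u * v * v * (r₁ * r₂ + r₁ * r₃ + r₂ * r₃)) * X ^ 2 + C (-(r₁ * r₂ * r₃ * v ^ 3)) * X ^ 3 +
        X ^ 4 * (B₁ * (C u + C (-(r₂ * v)) * X + X ^ 4 * B₂) * (C u + C (-(r₃ * v)) * X + X ^ 4 * B₃)
          + (C u + C (-(r₁ * v)) * X) * B₂ * (C u + C (-(r₃ * v)) * X + X ^ 4 * B₃) +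
          (C u + C (-(r₁ * v)) * X) * (C u + C (-(r₂ * v)) * X) * B₃) := by
      rw [hR, e₁, e₂, e₃]
      simp only [C_mul, C_add, C_neg, C_pow]
      ring
    rw [this]
    simp only [coeff_add, coeff_C_mul, coeff_X_pow, coeff_X_pow_mul', coeff_C]
    norm_num
    rw [hv]
    exact ⟨⟨⟨h₁, h₂⟩, h₃⟩, hde⟩
  obtain ⟨z, hz, hz'⟩ := exists_eval_ne_zero hdeg (by omega) hlt hcoeff
  rw [hR, eval_mul, eval_mul, eval_directionPoly hq, eval_directionPoly hq,
    eval_directionPoly hq] at hz'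
  exact ⟨z, hz, left_ne_zero_of_mul (left_ne_zero_of_mul hz'),
    right_ne_zero_of_mul (left_ne_zero_of_mul hz'), right_ne_zero_of_mul hz'⟩

theorem exists_two_nonvanishing (hσ : Function.Involutive σ) (hq : ∀ x, σ x = x ^ q)
    (hcard : Fintype.card K = q ^ 2) (hq3 : 3 ≤ q) {d e : K × K} (hd : wedge d (bar σ d) ≠ 0)
    {r : K} (hr : r ≠ 0) : ∃ z ≠ 0,
      wedge (e - (r * z) • d) (bar σ (e - (r * z) • d)) ≠ 0 ∧
      wedge (e - (-r * z) • d) (bar σ (e - (-r * z) • d)) ≠ 0 := by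
  have hn : ∀ r, (directionPoly σ q d e r).natDegree ≤ q + 1 :=
    natDegree_directionPoly_le (by omega) d e
  have h9 : (q + 1) + (q + 1) + 1 ≤ q ^ 2 := by nlinarith
  -- In this case the middle terms vanish and the polynomials for r and -r coincide, so one factor
  -- with its top coefficient suffices. Otherwise the X² coefficient of the product is used, which q
  -- ≥ 3 shields from the X ^ q terms.
  by_cases hde : wedge d (bar σ e) = 0
  · have hed : wedge e (bar σ d) = 0 := by
      have := congrArg σ hde
      simp only [wedge, bar, map_sub, map_mul, map_zero, hσ _] at this ⊢
      linear_combination -this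
    have hs : r * σ r ≠ 0 := mul_ne_zero hr ((map_ne_zero σ).2 hr)
    have hcoeff : (directionPoly σ q d e r).coeff (q + 1) ≠ 0 := by
      rw [directionPoly, hde, hed, mul_zero, mul_zero, C_0, zero_mul, sub_zero, zero_mul, sub_zero,
        coeff_add, coeff_C_mul_X_pow, coeff_C, if_neg (by omega), if_pos rfl, zero_add]
      exact mul_ne_zero hs hd
    obtain ⟨z, hz, hz'⟩ := exists_eval_ne_zero (i := q + 1) ((hn r).trans (by omega)) (by omega)
      (by omega) hcoeff
    rw [eval_directionPoly hq] at hz'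
    refine ⟨z, hz, hz', ?_⟩
    rw [← eval_directionPoly hq] at hz' ⊢
    simp only [directionPoly, hde, hed, mul_zero, C_0, zero_mul, sub_zero] at hz' ⊢
    rwa [map_neg, neg_mul_neg]
  · obtain ⟨R, hR⟩ : ∃ R, R = directionPoly σ q d e r * directionPoly σ q d e (-r) := ⟨_, rfl⟩
    have hdeg : R.natDegree ≤ Fintype.card K - 1 := by
      have : R.natDegree ≤ (q + 1) + (q + 1) := by
        rw [hR]
        exact natDegree_mul_le.trans (add_le_add (hn _) (hn _))
      omega
    have hcoeff : R.coeff 2 ≠ 0 := by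
      obtain ⟨k, rfl⟩ := Nat.exists_eq_add_of_le' hq3
      obtain ⟨B₁, e₁⟩ := directionPoly_eq (σ := σ) d e r k 3
      obtain ⟨B₂, e₂⟩ := directionPoly_eq (σ := σ) d e (-r) k 3
      obtain ⟨u, hu⟩ : ∃ u, u = wedge e (bar σ e) := ⟨_, rfl⟩
      obtain ⟨v, hv⟩ : ∃ v, v = wedge d (bar σ e) := ⟨_, rfl⟩
      rw [← hu, ← hv] at e₁ e₂
      have : R = C (u * u) + C (-(r * v * (r * v))) * X ^ 2 +
          X ^ 3 * (B₁ * (C u + C (r * v) * X + X ^ 3 * B₂) + (C u + C (-(r * v)) * X) * B₂) := by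
        rw [hR, e₁, e₂]
        simp only [C_mul, C_neg]
        ring
      rw [this]
      simp only [coeff_add, coeff_C_mul, coeff_X_pow, coeff_X_pow_mul', coeff_C]
      norm_num
      rw [hv]
      exact ⟨hr, hde⟩
    obtain ⟨z, hz, hz'⟩ := exists_eval_ne_zero hdeg (by omega) (by omega) hcoeff
    rw [hR, eval_mul, eval_directionPoly hq, eval_directionPoly hq] at hz'
    exact ⟨z, hz, left_ne_zero_of_mul hz', right_ne_zero_of_mul hz'⟩

end Nonvanishing

variable [Fintype K] {q : ℕ}

/-- Here q is even, and q = 2 is impossible: over the field of four elements there are just two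
non-real directions, conjugate to each other, so d would be proportional to e or to its conjugate.
The computation uses that all nonzero norms are then 1. -/
theorem four_le_of_two_eq_zero (hσ : Function.Involutive σ) (hq : ∀ x, σ x = x ^ q)
    (hcard : Fintype.card K = q ^ 2) (h2 : (2 : K) = 0) {d e : K × K}
    (hd : wedge d (bar σ d) ≠ 0) (he : wedge e (bar σ e) ≠ 0) (hde : wedge d e ≠ 0)
    (hde' : wedge d (bar σ e) ≠ 0) : 4 ≤ q := by
  have h1 : 1 < q ^ 2 := hcard ▸ Fintype.one_lt_card
  have hq0 : (q : K) = 0 := by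
    have := FiniteField.cast_card_eq_zero K
    rw [hcard, Nat.cast_pow] at this
    exact pow_eq_zero_iff (two_ne_zero) |>.1 this
  have hev : Even q := by
    by_contra h
    obtain ⟨m, rfl⟩ := Nat.not_even_iff_odd.1 h
    push_cast at hq0
    exact one_ne_zero (α := K) (by linear_combination hq0 - m * h2)
  have hne : q ≠ 2 := by
    rintro rfl
    have norm : ∀ x : K, x ≠ 0 → x * σ x = 1 := by
      intro x hx
      have := FiniteField.pow_card_sub_one_eq_one x hx
      rw [hcard] at this
      rw [hq, ← this]
      ring
    have e1 := norm _ hd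
    have e2 := norm _ he
    have e3 := norm _ hde'
    have e4 := norm _ hde
    have s1 : σ (wedge d (bar σ d)) = -wedge d (bar σ d) := by
      simp [wedge, bar, hσ _]; ring
    have s2 : σ (wedge e (bar σ e)) = -wedge e (bar σ e) := by
      simp [wedge, bar, hσ _]; ring
    have s3 : σ (wedge d (bar σ e)) = -wedge e (bar σ d) := by
      simp [wedge, bar, hσ _]; ring
    rw [s1] at e1
    rw [s2] at e2
    rw [s3] at e3
    have e5 : wedge d (bar σ d) * wedge e (bar σ e) - wedge d (bar σ e) * wedge e (bar σ d) =
        wedge d e * σ (wedge d e) := by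
      simp only [wedge, bar, map_sub, map_mul]
      ring
    have e6 : (wedge d (bar σ d) * wedge e (bar σ e)) * (wedge d (bar σ d) * wedge e (bar σ e)) =
        1 := by 
      linear_combination wedge e (bar σ e) * -wedge e (bar σ e) * e1 + e2
    have e7 : wedge d (bar σ d) * wedge e (bar σ e) = 0 := by
      linear_combination e5 + e4 - e3
    rw [e7] at e6
    simp at e6
  obtain ⟨m, rfl⟩ := hev
  have : m ≠ 0 := by rintro rfl; simp at h1
  omega

theorem three_le_of_two_ne_zero (hcard : Fintype.card K = q ^ 2) (h2 : (2 : K) ≠ 0) : 3 ≤ q := by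
  have h1 : 1 < q ^ 2 := hcard ▸ Fintype.one_lt_card
  have hne : q ≠ 2 := by
    rintro rfl
    have := FiniteField.cast_card_eq_zero K
    rw [hcard, Nat.cast_pow] at this
    exact h2 (by exact_mod_cast pow_eq_zero_iff (two_ne_zero) |>.1 this)
  have h0 : q ≠ 0 := by rintro rfl; simp at h1
  have h1 : q ≠ 1 := by rintro rfl; simp at h1
  omega

theorem exists_pappus_des_des (hσ : Function.Involutive σ) (hq : ∀ x, σ x = x ^ q)
    (hcard : Fintype.card K = q ^ 2) {d e : K × K} (hd : wedge d (bar σ d) ≠ 0)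
    (he : wedge e (bar σ e) ≠ 0) (hde : wedge d e ≠ 0) {A B C : K × K}
    (hA : A ∈ desLine 0 d \ desLine 0 e) (hB : B ∈ desLine 0 d \ desLine 0 e)
    (hC : C ∈ desLine 0 d \ desLine 0 e) (hAB : A ≠ B) (hAC : A ≠ C) (hBC : B ≠ C) :
    ∃ A₂ B₂ C₂, IsPappusConfiguration (lines σ) (desLine 0 d) (desLine 0 e) A B C A₂ B₂ C₂ := by
  have opp : ∀ {a b c : K}, a ≠ 0 → b ≠ 0 → c ≠ 0 → a ≠ b → a ≠ c → b ≠ c → b + c = 0 →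
      ∃ A₂ B₂ C₂, IsPappusConfiguration (lines σ) (desLine 0 d) (desLine 0 e)
        (a • d) (b • d) (c • d) A₂ B₂ C₂ := by
    intro a b c ha hb hc hab hac hbc h
    have h2 := two_ne_zero_of_add_eq_zero hbc h
    obtain rfl : c = -b := by linear_combination h
    obtain ⟨z, hz, hz1, hz2⟩ := exists_two_nonvanishing hσ hq hcard
      (three_le_of_two_ne_zero hcard h2) (e := e) hd (mul_ne_zero ha hb)
    refine ⟨_, _, _, pappus_of_nonvanishing hd he hde ha hb hc hz hab hac hbc (Or.inr ?_)
      (Or.inl ?_) (Or.inl hz1)⟩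
    -- The pair with ratio c/b = -1 is parallel for every z, so only two directions had to be kept
    -- non-real.
    · rw [neg_div, div_self hb]; simp
    · rwa [mul_neg]
  have d0 := ne_zero_of_wedge hd
  obtain ⟨a, rfl⟩ := (mem_desLine_zero d0).1 hA.1
  obtain ⟨b, rfl⟩ := (mem_desLine_zero d0).1 hB.1
  obtain ⟨c, rfl⟩ := (mem_desLine_zero d0).1 hC.1
  have n0 : ∀ {x : K}, x • d ∈ desLine 0 d \ desLine 0 e → x ≠ 0 := by
    rintro x hx rfl
    exact hx.2 (by simpa using base_mem_desLine 0 e)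
  have inj : ∀ {x y : K}, x • d ≠ y • d → x ≠ y := fun h h' => h (h' ▸ rfl)
  have a0 := n0 hA
  have b0 := n0 hB
  have c0 := n0 hC
  have hab := inj hAB
  have hac := inj hAC
  have hbc := inj hBC
  by_cases hab' : a + b = 0
  · obtain ⟨C₂, A₂, B₂, h⟩ := opp c0 a0 b0 hac.symm hbc.symm hab hab'
    exact ⟨A₂, B₂, C₂, h.swap_AB.swap_BC⟩
  by_cases hac' : a + c = 0
  · obtain ⟨B₂, A₂, C₂, h⟩ := opp b0 a0 c0 hab.symm hbc hac hac'
    exact ⟨A₂, B₂, C₂, h.swap_AB⟩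
  by_cases hbc' : b + c = 0
  · exact opp a0 b0 c0 hab hac hbc hbc'
  by_cases hde' : wedge d (bar σ e) = 0
  · have h := (pappus_of_conjugation hσ hd a0 b0 c0 hab hac hbc hab' hac' hbc').2
    have hs : wedge (bar σ d) (bar σ (bar σ d)) ≠ 0 := by
      rw [wedge_bar_bar]
      exact (map_ne_zero σ).2 hd
    have e0 : desLine 0 (bar σ d) = desLine 0 e := by
      refine desLine_eq (base_mem_desLine _ _) (ne_zero_of_wedge hs) (ne_zero_of_wedge he) ?_
      have := congrArg σ hde'
      simp only [wedge, bar, map_sub, map_mul, map_zero, hσ _] at this ⊢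
      linear_combination -this
    rw [e0] at h
    exact ⟨_, _, _, h⟩
  -- In characteristic 2 there is no reflection, and the free parameter z takes over.
  by_cases h2 : (2 : K) = 0
  · obtain ⟨z, hz, hz1, hz2, hz3⟩ := exists_three_nonvanishing hq hcard
      (four_le_of_two_eq_zero hσ hq hcard h2 hd he hde hde') hde' (mul_ne_zero b0 c0)
      (mul_ne_zero a0 c0) (mul_ne_zero a0 b0)
    exact ⟨_, _, _, pappus_of_nonvanishing hd he hde a0 b0 c0 hz hab hac hbc (Or.inl hz1)
      (Or.inl hz2) (Or.inl hz3)⟩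
  · refine pappus_of_reflection hσ ?_ h2 hd he hde hde' a0 b0 c0 hab hac hbc hab' hac' hbc'
    by_contra! h
    apply hd
    simp only [wedge, bar, h]
    ring

end HallModel

/-- Any three distinct points of `l₁` off `l₂` are part of a Pappus configuration on `l₁, l₂`. -/
def HasPappus {X : Type*} (L : Set (Set X)) (l₁ l₂ : Set X) : Prop :=
  ∀ A B C, A ∈ l₁ \ l₂ → B ∈ l₁ \ l₂ → C ∈ l₁ \ l₂ → A ≠ B → A ≠ C → B ≠ C →
    ∃ A₂ B₂ C₂, IsPappusConfiguration L l₁ l₂ A B C A₂ B₂ C₂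

theorem HasPappus.image {X Y : Type*} {L : Set (Set X)} {L' : Set (Set Y)} {l₁ l₂ : Set X}
    (e : X ≃ Y) (he : ∀ l ∈ L, e '' l ∈ L') (h : HasPappus L l₁ l₂) :
    HasPappus L' (e '' l₁) (e '' l₂) := by
  have mem : ∀ {P}, P ∈ (e '' l₁) \ (e '' l₂) → ∃ Q ∈ l₁ \ l₂, e Q = P := by
    rintro P ⟨⟨Q, hQ, rfl⟩, hQ'⟩
    exact ⟨Q, ⟨hQ, fun hn => hQ' ⟨Q, hn, rfl⟩⟩, rfl⟩
  intro A B C hA hB hC hAB hAC hBC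
  obtain ⟨A, hA', rfl⟩ := mem hA
  obtain ⟨B, hB', rfl⟩ := mem hB
  obtain ⟨C, hC', rfl⟩ := mem hC
  obtain ⟨A₂, B₂, C₂, h⟩ := h A B C hA' hB' hC' (e.injective.ne_iff.1 hAB) (e.injective.ne_iff.1 hAC)
    (e.injective.ne_iff.1 hBC)
  exact ⟨_, _, _, h.map e he⟩

/-! ### Lines in arbitrary position. -/

namespace HallModel

variable {K : Type*} [Field K] {σ : K →+* K}

/-- The permutation `x ↦ k x + t` of `K × K`. -/
def homothety (k : Kˣ) (t : K × K) : K × K ≃ K × K where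
  toFun v := k • v + t
  invFun v := k⁻¹ • (v - t)
  left_inv v := by simp
  right_inv v := by simp

theorem image_homothety_desLine (k : Kˣ) (t v d : K × K) :
    homothety k t '' desLine v d = desLine (k • v + t) d := by
  rw [Equiv.image_eq_preimage_symm]
  ext x
  obtain ⟨x, rfl⟩ := (homothety k t).surjective x
  simp only [Set.mem_preimage, Equiv.symm_apply_apply]
  rw [mem_desLine, mem_desLine]
  simp only [homothety, Equiv.coe_fn_mk, Prod.fst_add, Prod.snd_add, Prod.smul_fst, Prod.smul_snd,
    Units.smul_def, smul_eq_mul]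
  rw [← mul_eq_zero_iff_left k.ne_zero]
  ring_nf

theorem image_homothety_baerLine (k : Kˣ) (t v : K × K) (e : K) :
    homothety k t '' baerLine σ v e = baerLine σ (k • v + t) (k * e) := by
  rw [Equiv.image_eq_preimage_symm]
  ext x
  obtain ⟨x, rfl⟩ := (homothety k t).surjective x
  simp only [Set.mem_preimage, Equiv.symm_apply_apply]
  have hk : (k : K) * σ k ≠ 0 := mul_ne_zero k.ne_zero ((map_ne_zero σ).2 k.ne_zero)
  rw [mem_baerLine, mem_baerLine]
  simp only [homothety, Equiv.coe_fn_mk, Prod.fst_add, Prod.snd_add, Prod.smul_fst, Prod.smul_snd,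
    Units.smul_def, smul_eq_mul, map_add, map_mul]
  rw [← mul_right_inj' hk, ← mul_right_inj' (b := e * (σ x.2 - σ v.2)) hk]
  ring_nf

theorem image_homothety_mem (k : Kˣ) (t : K × K) : ∀ l ∈ lines σ, homothety k t '' l ∈ lines σ := by
  rintro _ (⟨v, d, hd, rfl⟩ | ⟨v, e, he, rfl⟩)
  · rw [image_homothety_desLine]
    exact desLine_mem hd
  · rw [image_homothety_baerLine]
    exact baerLine_mem (mul_ne_zero k.ne_zero he)

/-- The second triple is the image of the first under the point reflection P ↦ A + R - P. The vector
from P to the image of Q is symmetric in P and Q, so each pair of joins is parallel. -/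
theorem hasPappus_of_translate {l₁ l₂ : Set (K × K)} (h₁ : l₁ ∈ lines σ) (h₂ : l₂ ∈ lines σ)
    (hd : Disjoint l₁ l₂) (h : ∀ P ∈ l₁, ∀ Q ∈ l₁, ∀ R ∈ l₂, P - Q + R ∈ l₂) :
    HasPappus (lines σ) l₁ l₂ := by
  intro A B C hA hB hC hAB hAC hBC
  obtain ⟨R, hR⟩ : ∃ R, R ∈ l₂ := by
    rcases h₂ with ⟨v, d, _, rfl⟩ | ⟨v, e, _, rfl⟩
    · exact ⟨v, base_mem_desLine _ _⟩
    · exact ⟨v, base_mem_baerLine _ _⟩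
  have mem : ∀ {P}, P ∈ l₂ → P ∈ l₂ \ l₁ := fun hP => ⟨hP, fun h' => Set.disjoint_left.1 hd h' hP⟩
  have off : ∀ {P Q}, P ∈ l₁ → Q ∈ l₂ → P ≠ Q := fun hP hQ h' => Set.disjoint_left.1 hd hP (h' ▸ hQ)
  have h1 := h A hA.1 B hB.1 R hR
  have h2 := h A hA.1 C hC.1 R hR
  refine ⟨R, A - B + R, A - C + R, .of_parallel uniqueJoin h₁ h₂ hA hB hC (mem hR) (mem h1) (mem h2)
    hAB hAC hBC ?_ ?_ ?_ (parallel_of_smul (k := 1) (map_one σ) (off hB.1 h2) ?_)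
    (parallel_of_smul (k := 1) (map_one σ) (off hA.1 h2) ?_)
    (parallel_of_smul (k := 1) (map_one σ) (off hA.1 h1) ?_)⟩
  · intro h'
    exact hAB (sub_eq_zero.1 (by simpa using h'.symm))
  · intro h'
    exact hAC (sub_eq_zero.1 (by simpa using h'.symm))
  · intro h'
    exact hBC (by simpa using h')
  all_goals rw [one_smul]; abel

theorem sub_add_mem_desLine {v v' d P Q R : K × K} (hP : P ∈ desLine v d) (hQ : Q ∈ desLine v d)
    (hR : R ∈ desLine v' d) : P - Q + R ∈ desLine v' d := by
  rw [mem_desLine] at *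
  simp only [Prod.fst_add, Prod.snd_add, Prod.fst_sub, Prod.snd_sub]
  linear_combination hP - hQ + hR

theorem sub_add_mem_baerLine {v v' P Q R : K × K} {e : K} (hP : P ∈ baerLine σ v e)
    (hQ : Q ∈ baerLine σ v e) (hR : R ∈ baerLine σ v' e) : P - Q + R ∈ baerLine σ v' e := by
  rw [mem_baerLine] at *
  simp only [Prod.fst_add, Prod.snd_add, Prod.fst_sub, Prod.snd_sub, map_add, map_sub]
  exact ⟨by linear_combination hP.1 - hQ.1 + hR.1, by linear_combination hP.2 - hQ.2 + hR.2⟩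

theorem hasPappus_des_des [Fintype K] {q : ℕ} (hσ : Function.Involutive σ) (hq : ∀ x, σ x = x ^ q)
    (hcard : Fintype.card K = q ^ 2) {v d v' d' : K × K} (hd : wedge d (bar σ d) ≠ 0)
    (hd' : wedge d' (bar σ d') ≠ 0) (hne : desLine v d ≠ desLine v' d') :
    HasPappus (lines σ) (desLine v d) (desLine v' d') := by
  by_cases h : wedge d d' = 0
  · rw [desLine_eq (base_mem_desLine v' d') (ne_zero_of_wedge hd') (ne_zero_of_wedge hd) h] at hne ⊢
    exact hasPappus_of_translate (desLine_mem hd) (desLine_mem hd)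
      ((desLine_eq_or_disjoint _ _ _).resolve_left hne)
      fun P hP Q hQ R hR => sub_add_mem_desLine hP hQ hR
  · obtain ⟨X, hX, hX'⟩ := desLine_meet_desLine (v := v) (v' := v') h
    rw [desLine_eq hX (ne_zero_of_wedge hd) (ne_zero_of_wedge hd) (by simp [wedge, mul_comm]),
      desLine_eq hX' (ne_zero_of_wedge hd') (ne_zero_of_wedge hd') (by simp [wedge, mul_comm])]
    have key : HasPappus (lines σ) (desLine 0 d) (desLine 0 d') :=
      fun A B C hA hB hC hAB hAC hBC =>
        exists_pappus_des_des hσ hq hcard hd hd' h hA hB hC hAB hAC hBC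
    have := key.image (homothety 1 X) (image_homothety_mem 1 X)
    simpa only [image_homothety_desLine, smul_zero, zero_add] using this

theorem hasPappus_baer_baer (hσ : Function.Involutive σ) {v v' : K × K} {e e' : K} (he : e ≠ 0)
    (he' : e' ≠ 0) (hne : baerLine σ v e ≠ baerLine σ v' e') :
    HasPappus (lines σ) (baerLine σ v e) (baerLine σ v' e') := by
  by_cases h : e * σ e' = σ e * e'
  · rw [baerLine_eq (base_mem_baerLine v' e') he' he (by linear_combination -h)] at hne ⊢
    exact hasPappus_of_translate (baerLine_mem he) (baerLine_mem he)
      ((baerLine_eq_or_disjoint _ _ he).resolve_left hne)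
      fun P hP Q hQ R hR => sub_add_mem_baerLine hP hQ hR
  · obtain ⟨X, hX, hX'⟩ := baerLine_meet_baerLine hσ (v := v) (v' := v') h
    rw [baerLine_eq hX he he (mul_comm _ _), baerLine_eq hX' he' he' (mul_comm _ _)]
    have key : HasPappus (lines σ) (baerLine σ 0 e) (baerLine σ 0 e') :=
      fun A B C hA hB hC hAB hAC hBC => exists_pappus_baer_baer he he' h hA hB hC hAB hAC hBC
    have := key.image (homothety 1 X) (image_homothety_mem 1 X)
    simpa only [image_homothety_baerLine, smul_zero, zero_add, Units.val_one, one_mul] using this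

theorem hasPappus_des_baer (hσ : Function.Involutive σ) {v d v' : K × K} {e : K}
    (hd : wedge d (bar σ d) ≠ 0) (he : e ≠ 0) :
    HasPappus (lines σ) (desLine v d) (baerLine σ v' e) := by
  obtain ⟨X, hX, hX'⟩ := desLine_meet_baerLine hσ (v := v) (v' := v') hd he
  rw [desLine_eq hX (ne_zero_of_wedge hd) (ne_zero_of_wedge hd) (by simp [wedge, mul_comm]),
    baerLine_eq hX' he he (mul_comm _ _)]
  have key : HasPappus (lines σ) (desLine 0 d) (baerLine σ 0 1) :=
    fun A B C hA hB hC hAB hAC hBC => exists_pappus_des_baer hσ hd hA hB hC hAB hAC hBC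
  have := key.image (homothety (Units.mk0 e he) X) (image_homothety_mem _ X)
  simpa only [image_homothety_desLine, image_homothety_baerLine, smul_zero, zero_add,
    Units.val_mk0, mul_one] using this

end HallModel

/-! ### The isomorphism with the Hall plane. -/

namespace HallModel

variable {F K : Type*} [Field F] [Field K] [Algebra F K] {σ : K →+* K} {r s : F} {ω : K}

local notation "ι" => algebraMap F K

/-- The map of the Hall plane onto `K × K` given by an element `ω` generating `K` over `F`. -/
def ofPoint (ω : K) (P : HallPlane.Point F) : K × K :=
  (ι P.2.1 + ι P.1.1 * ω, ι P.2.2 + ι P.1.2 * ω)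

theorem eq_zero_of_add_mul (hF : ∀ a : F, σ (ι a) = ι a) (hω : σ ω ≠ ω) {a b : F}
    (h : ι a + ι b * ω = 0) : a = 0 ∧ b = 0 := by
  have h' := congrArg σ h
  simp only [map_add, map_mul, hF, map_zero] at h'
  have hb : b = 0 := by
    have : ι b * (σ ω - ω) = 0 := by linear_combination h' - h
    simpa [sub_ne_zero.2 hω] using this
  subst hb
  simpa using h

theorem ofPoint_injective (hF : ∀ a : F, σ (ι a) = ι a) (hω : σ ω ≠ ω) :
    Function.Injective (ofPoint (F := F) ω) := by
  rintro ⟨⟨a, b⟩, c, d⟩ ⟨⟨a', b'⟩, c', d'⟩ h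
  simp only [ofPoint, Prod.mk.injEq] at h
  have h1 := eq_zero_of_add_mul hF hω (a := c - c') (b := a - a')
    (by simp only [map_sub]; linear_combination h.1)
  have h2 := eq_zero_of_add_mul hF hω (a := d - d') (b := b - b')
    (by simp only [map_sub]; linear_combination h.2)
  simp only [sub_eq_zero] at h1 h2
  rw [h1.1, h1.2, h2.1, h2.2]

theorem preimage_baerLine_one (hF : ∀ a : F, σ (ι a) = ι a) (hω : σ ω ≠ ω) (c : F × F) :
    ofPoint ω ⁻¹' baerLine σ (ι c.1 * ω, ι c.2 * ω) 1 = HallPlane.vertical c := by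
  ext ⟨⟨a, b⟩, a', b'⟩
  have key : ∀ {x y z : F}, σ (ι x + ι y * ω) - σ (ι z * ω) = ι x + ι y * ω - ι z * ω ↔ y = z := by
    intro x y z
    simp only [map_add, map_mul, hF]
    have : ι x + ι y * σ ω - ι z * σ ω = ι x + ι y * ω - ι z * ω ↔ ι (y - z) * (σ ω - ω) = 0 := by
      rw [map_sub]
      constructor <;> intro h
      · linear_combination h
      · linear_combination h
    rw [this]
    simp [sub_ne_zero.2 hω, sub_eq_zero]
  simp only [Set.mem_preimage, mem_baerLine, ofPoint, HallPlane.vertical, Set.mem_ofPred_eq, map_one,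
    one_mul, key, Prod.ext_iff]

theorem wedge_direction_ne_zero (hF : ∀ a : F, σ (ι a) = ι a) (hω : σ ω ≠ ω) {m : F × F}
    (hm : m.2 ≠ 0) : wedge (ι m.1 + ω, ι m.2) (bar σ (ι m.1 + ω, ι m.2)) ≠ 0 := by
  intro h
  simp only [wedge, bar, map_add, hF] at h
  have : ι m.2 * (σ ω - ω) = 0 := by linear_combination -h
  simp [sub_ne_zero.2 hω, hm] at this

theorem add_generator_ne_zero (hF : ∀ a : F, σ (ι a) = ι a) (hω : σ ω ≠ ω) (m : F) :
    ι m + ω ≠ 0 := by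
  intro h
  simpa using (eq_zero_of_add_mul hF hω (a := m) (b := 1) (by simpa using h)).2

theorem mem_range_of_fixed (hF : ∀ a : F, σ (ι a) = ι a) (hω : σ ω ≠ ω)
    (hs : Function.Surjective (ofPoint (F := F) ω)) {x : K} (hx : σ x = x) : ∃ a : F, ι a = x := by
  obtain ⟨⟨⟨b, _⟩, a, _⟩, h⟩ := hs (x, 0)
  simp only [ofPoint, Prod.mk.injEq] at h
  rw [← h.1] at hx ⊢
  simp only [map_add, map_mul, hF] at hx
  have : ι b * (σ ω - ω) = 0 := by linear_combination hx
  have hb : b = 0 := by simpa [sub_ne_zero.2 hω] using this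
  exact ⟨a, by simp [hb]⟩

theorem exists_mem_range (hF : ∀ a : F, σ (ι a) = ι a) (hω : σ ω ≠ ω)
    (hs : Function.Surjective (ofPoint (F := F) ω)) {X : K × K} (hX : X ∈ baerLine σ 0 1) :
    ∃ k : F × F, X = (ι k.1, ι k.2) := by
  simp only [mem_baerLine, map_one, one_mul, Prod.fst_zero, Prod.snd_zero, map_zero, sub_zero] at hX
  obtain ⟨a, ha⟩ := mem_range_of_fixed hF hω hs hX.1
  obtain ⟨b, hb⟩ := mem_range_of_fixed hF hω hs hX.2
  exact ⟨(a, b), by rw [ha, hb]⟩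

variable [DecidableEq F]

theorem preimage_baerLine (hF : ∀ a : F, σ (ι a) = ι a) (hω : σ ω ≠ ω) (m : F) (k : F × F) :
    ofPoint ω ⁻¹' baerLine σ (ι k.1, ι k.2) (ι m + ω) = HallPlane.nonVertical r s (m, 0) k := by
  ext ⟨⟨a, b⟩, a', b'⟩
  have key : ∀ {x y z : F}, (ι m + ω) * (σ (ι x + ι y * ω) - σ (ι z)) =
      σ (ι m + ω) * (ι x + ι y * ω - ι z) ↔ x = y * m + z := by
    intro x y z
    simp only [map_add, map_mul, hF]
    have : (ι m + ω) * (ι x + ι y * σ ω - ι z) = (ι m + σ ω) * (ι x + ι y * ω - ι z) ↔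
        ι (x - (y * m + z)) * (σ ω - ω) = 0 := by
      simp only [map_sub, map_add, map_mul]
      constructor <;> intro h
      · linear_combination -h
      · linear_combination -h
    rw [this, mul_eq_zero, map_eq_zero, sub_eq_zero (a := x)]
    simp [sub_ne_zero.2 hω]
  simp only [Set.mem_preimage, mem_baerLine, ofPoint, HallPlane.nonVertical, HallPlane.hallMul,
    Set.mem_ofPred_eq, key, Prod.ext_iff, if_true, Prod.fst_add, Prod.snd_add]

/-- Expanded in the basis 1, ω by means of the quadratic relation, the single equation over K splits
into two equations over F, which are equivalent to the Hall multiplication by m. -/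
theorem preimage_desLine (hF : ∀ a : F, σ (ι a) = ι a) (hω : σ ω ≠ ω)
    (hrs : ω ^ 2 = ι s - ι r * ω) {m : F × F} (hm : m.2 ≠ 0) (k : F × F) :
    ofPoint ω ⁻¹' desLine (ι k.1, ι k.2) (ι m.1 + ω, ι m.2) = HallPlane.nonVertical r s m k := by
  ext ⟨⟨a, b⟩, a', b'⟩
  obtain ⟨m, n⟩ := m
  obtain ⟨k, l⟩ := k
  simp only at hm
  have : (ι a' + ι a * ω - ι k) * ι n - (ι b' + ι b * ω - ι l) * (ι m + ω) =
      ι ((a' - k) * n - (b' - l) * m - s * b) + ι (a * n - (b' - l) - b * m + r * b) * ω := by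
    simp only [map_sub, map_add, map_mul]
    linear_combination -ι b * hrs
  simp only [Set.mem_preimage, mem_desLine, ofPoint, HallPlane.nonVertical, HallPlane.hallMul,
    Set.mem_ofPred_eq, this, Prod.ext_iff, if_neg hm, Prod.fst_add, Prod.snd_add]
  constructor
  · intro h
    obtain ⟨h1, h2⟩ := eq_zero_of_add_mul hF hω h
    refine ⟨?_, by linear_combination -h2⟩
    field_simp
    linear_combination h1 - m * h2
  · rintro ⟨h1, h2⟩
    have h3 : (a' - k) * n - (b' - l) * m - s * b = 0 := by
      rw [h1, h2]
      field_simp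
      ring
    rw [h3, h2]
    simp only [map_sub, map_add, map_mul, map_zero]
    ring

theorem exists_baerLine_of_isBF (hF : ∀ a : F, σ (ι a) = ι a) (hω : σ ω ≠ ω)
    {l : Set (HallPlane.Point F)} (hl : HallPlane.IsBF r s l) :
    ∃ v e, e ≠ 0 ∧ l = ofPoint ω ⁻¹' baerLine σ v e := by
  rcases hl with ⟨c, rfl⟩ | ⟨⟨m, n⟩, k, hn, rfl⟩
  · exact ⟨_, 1, one_ne_zero, (preimage_baerLine_one hF hω c).symm⟩
  · simp only at hn
    subst hn
    exact ⟨_, _, add_generator_ne_zero hF hω m, (preimage_baerLine hF hω m k).symm⟩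

theorem exists_desLine_of_isNBF (hF : ∀ a : F, σ (ι a) = ι a) (hω : σ ω ≠ ω)
    (hrs : ω ^ 2 = ι s - ι r * ω) {l : Set (HallPlane.Point F)} (hl : HallPlane.IsNBF r s l) :
    ∃ v d, wedge d (bar σ d) ≠ 0 ∧ l = ofPoint ω ⁻¹' desLine v d := by
  obtain ⟨m, k, hm, rfl⟩ := hl
  exact ⟨_, _, wedge_direction_ne_zero hF hω hm, (preimage_desLine hF hω hrs hm k).symm⟩

theorem preimage_mem_lines (hσ : Function.Involutive σ) (hF : ∀ a : F, σ (ι a) = ι a)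
    (hω : σ ω ≠ ω) (hrs : ω ^ 2 = ι s - ι r * ω) (hs : Function.Surjective (ofPoint (F := F) ω)) :
    ∀ l ∈ lines σ, ofPoint ω ⁻¹' l ∈ HallPlane.lines r s := by
  have coord : ∀ x : K, ∃ a b : F, x = ι a + ι b * ω := by
    intro x
    obtain ⟨⟨⟨b, _⟩, a, _⟩, h⟩ := hs (x, 0)
    exact ⟨a, b, (congrArg Prod.fst h).symm⟩
  rintro _ (⟨v, d, hd, rfl⟩ | ⟨v, e, he, rfl⟩)
  -- The real points are the image of the vertical line x = 0, so the base point is moved to the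
  -- intercept k. The direction is normalised to (m/n + ω, 1/n).
  · obtain ⟨X, hX, hX'⟩ := desLine_meet_baerLine hσ (v := v) (v' := 0) hd one_ne_zero
    obtain ⟨k, rfl⟩ := exists_mem_range hF hω hs hX'
    have d2 : d.2 ≠ 0 := by
      intro h
      simp [wedge, bar, h] at hd
    obtain ⟨m, n, hmn⟩ := coord (d.1 / d.2)
    rw [div_eq_iff d2] at hmn
    have hn : n ≠ 0 := by
      rintro rfl
      apply hd
      simp only [wedge, bar, hmn, map_mul, map_add, hF, map_zero]
      ring
    have hn' : n⁻¹ ≠ 0 := inv_ne_zero hn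
    rw [desLine_eq hX (ne_zero_of_wedge hd)
      (ne_zero_of_wedge (wedge_direction_ne_zero hF hω (m := (m / n, n⁻¹)) hn')) ?_,
      preimage_desLine hF hω hrs (m := (m / n, n⁻¹)) hn' k]
    · exact Or.inr ⟨_, _, rfl⟩
    · have : ι n ≠ 0 := by simpa using hn
      simp only [wedge, hmn, map_div₀, map_inv₀]
      field_simp
      ring
  · obtain ⟨m, n, rfl⟩ := coord e
    -- A multiplier in F gives a vertical line; any other is proportional over F to m/n + ω.
    by_cases hn : n = 0
    · subst hn
      obtain ⟨a, b, hv⟩ := coord v.1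
      obtain ⟨a', b', hv'⟩ := coord v.2
      have hX : (ι b * ω, ι b' * ω) ∈ baerLine σ v (ι m + ι 0 * ω) := by
        simp only [mem_baerLine, hv, hv', map_add, map_mul, hF, map_zero]
        constructor <;> ring
      rw [baerLine_eq hX he one_ne_zero (by simp [hF])]
      exact Or.inl ⟨_, preimage_baerLine_one hF hω (b, b')⟩
    · have hn' : ι n ≠ 0 := by simpa using hn
      obtain ⟨X, hX, hX'⟩ := baerLine_meet_baerLine hσ (v := v) (v' := 0)
        (e := ι m + ι n * ω) (e' := 1) (by
          simp only [map_one, mul_one, map_add, map_mul, hF]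
          intro h
          exact mul_ne_zero hn' (sub_ne_zero.2 hω) (by linear_combination -h))
      obtain ⟨k, rfl⟩ := exists_mem_range hF hω hs hX'
      rw [baerLine_eq hX he (add_generator_ne_zero hF hω (m / n)) (by
        simp only [map_add, map_mul, map_div₀, hF]
        field_simp), preimage_baerLine hF hω]
      exact Or.inr ⟨_, _, rfl⟩

theorem hasPappus_hallPlane [Fintype F] [Fintype K] (hq : ∀ x, σ x = x ^ Fintype.card F)
    (hcard : Fintype.card K = Fintype.card F ^ 2) (hω : σ ω ≠ ω) (hrs : ω ^ 2 = ι s - ι r * ω)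
    {l₁ l₂ : Set (HallPlane.Point F)} (hne : l₁ ≠ l₂)
    (hl : (HallPlane.IsBF r s l₁ ∧ HallPlane.IsBF r s l₂) ∨
      (HallPlane.IsNBF r s l₁ ∧ HallPlane.IsNBF r s l₂) ∨
      (HallPlane.IsNBF r s l₁ ∧ HallPlane.IsBF r s l₂)) :
    HasPappus (HallPlane.lines r s) l₁ l₂ := by
  have hF : ∀ a : F, σ (ι a) = ι a := by
    intro a
    rw [hq, ← map_pow, FiniteField.pow_card]
  have hσ : Function.Involutive σ := by
    intro x
    rw [hq, hq, ← pow_mul, ← sq, ← hcard, FiniteField.pow_card]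
  have hb : Function.Bijective (ofPoint (F := F) ω) := by
    refine (Fintype.bijective_iff_injective_and_card _).2 ⟨ofPoint_injective hF hω, ?_⟩
    simp only [Fintype.card_prod, hcard]
    ring
  have transfer : ∀ {l₁ l₂ : Set (K × K)}, HasPappus (lines σ) l₁ l₂ →
      HasPappus (HallPlane.lines r s) (ofPoint ω ⁻¹' l₁) (ofPoint ω ⁻¹' l₂) := by
    intro l₁ l₂ h
    have im : ∀ l, (Equiv.ofBijective _ hb).symm '' l = ofPoint (F := F) ω ⁻¹' l := fun l => by
      rw [Equiv.image_symm_eq_preimage]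
      rfl
    rw [← im, ← im]
    refine h.image _ fun l hl => ?_
    rw [im]
    exact preimage_mem_lines hσ hF hω hrs hb.2 l hl
  rcases hl with ⟨h₁, h₂⟩ | ⟨h₁, h₂⟩ | ⟨h₁, h₂⟩
  · obtain ⟨v, e, he, rfl⟩ := exists_baerLine_of_isBF hF hω h₁
    obtain ⟨v', e', he', rfl⟩ := exists_baerLine_of_isBF hF hω h₂
    exact transfer (hasPappus_baer_baer hσ he he' fun h => hne (by rw [h]))
  · obtain ⟨v, d, hd, rfl⟩ := exists_desLine_of_isNBF hF hω hrs h₁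
    obtain ⟨v', d', hd', rfl⟩ := exists_desLine_of_isNBF hF hω hrs h₂
    exact transfer (hasPappus_des_des hσ hq hcard hd hd' fun h => hne (by rw [h]))
  · obtain ⟨v, d, hd, rfl⟩ := exists_desLine_of_isNBF hF hω hrs h₁
    obtain ⟨v', e, he, rfl⟩ := exists_baerLine_of_isBF hF hω h₂
    exact transfer (hasPappus_des_baer hσ hd he)

end HallModel

/-! ### The theorem for the Hall plane. -/

open Polynomial HallPlane in
theorem theorem2 {F : Type*} [Field F] [Finite F] [DecidableEq F] (r s : F)
    (hf : Irreducible (X ^ 2 - C r * X - C s : F[X]))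
    (l₁ l₂ : Set (Point F)) (hne : l₁ ≠ l₂)
    (hl : (IsBF r s l₁ ∧ IsBF r s l₂) ∨ (IsNBF r s l₁ ∧ IsNBF r s l₂) ∨
      (IsNBF r s l₁ ∧ IsBF r s l₂))
    (A₁ B₁ C₁ : Point F) (hA₁ : A₁ ∈ l₁ \ l₂) (hB₁ : B₁ ∈ l₁ \ l₂) (hC₁ : C₁ ∈ l₁ \ l₂)
    (hAB : A₁ ≠ B₁) (hAC : A₁ ≠ C₁) (hBC : B₁ ≠ C₁) :
    ∃ A₂ ∈ l₂, ∃ B₂ ∈ l₂, ∃ C₂ ∈ l₂,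
      IsPappusConfiguration (lines r s) l₁ l₂ A₁ B₁ C₁ A₂ B₂ C₂ := by
  have := Fintype.ofFinite F
  have := Fact.mk hf
  have hdeg : (X ^ 2 - C r * X - C s : F[X]).natDegree = 2 := by compute_degree!
  let pb := AdjoinRoot.powerBasis hf.ne_zero
  have : Module.Finite F (AdjoinRoot (X ^ 2 - C r * X - C s)) := pb.finite
  have : Finite (AdjoinRoot (X ^ 2 - C r * X - C s)) := Module.finite_of_finite F
  have := Fintype.ofFinite (AdjoinRoot (X ^ 2 - C r * X - C s))
  have hrank : Module.finrank F (AdjoinRoot (X ^ 2 - C r * X - C s)) = 2 := by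
    rw [pb.finrank, AdjoinRoot.powerBasis_dim, hdeg]
  have hcard : Fintype.card (AdjoinRoot (X ^ 2 - C r * X - C s)) = Fintype.card F ^ 2 := by
    rw [Module.card_eq_pow_finrank (K := F), hrank]
  have hroot := AdjoinRoot.eval₂_root (X ^ 2 - C r * X - C s)
  simp only [eval₂_sub, eval₂_mul, eval₂_pow, eval₂_X, eval₂_C, ← AdjoinRoot.algebraMap_eq] at hroot
  obtain ⟨A₂, B₂, C₂, h⟩ := HallModel.hasPappus_hallPlane (r := r) (s := s)
    -- The negative of the other root of f, chosen because the coordinates require ω² = s - rω.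
    (ω := AdjoinRoot.root (X ^ 2 - C r * X - C s) - algebraMap F _ r)
    (σ := (FiniteField.frobeniusAlgHom F (AdjoinRoot (X ^ 2 - C r * X - C s))).toRingHom)
    (fun x => rfl) hcard
    (by
      intro h
      -- A Frobenius map fixing ω fixes the root and so is the identity, although its order is the
      -- degree 2.
      have hid : FiniteField.frobeniusAlgHom F (AdjoinRoot (X ^ 2 - C r * X - C s)) = 1 := by
        apply AdjoinRoot.algHom_ext
        change FiniteField.frobeniusAlgHom F _ (_ - algebraMap F _ r) = _ at h
        rwa [map_sub, AlgHom.commutes, sub_left_inj] at h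
      have := FiniteField.orderOf_frobeniusAlgHom F (AdjoinRoot (X ^ 2 - C r * X - C s))
      rw [hid, orderOf_one, hrank] at this
      omega)
    (by linear_combination hroot) hne hl A₁ B₁ C₁ hA₁ hB₁ hC₁ hAB hAC hBC
  exact ⟨A₂, h.memA₂.1, B₂, h.memB₂.1, C₂, h.memC₂.1, h⟩
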